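/- Let $k$ be a field of characteristic zero; all operads are symmetric operads in $k$-vector spaces. Let $\mathrm{FM}$ be the operad of $F$-manifold algebras: it is generated by a symmetric binary operation $\circ$ and a skew-symmetric binary operation $[-,-]$, subject to associativity $(a_1\circ a_2)\circ a_3=a_1\circ(a_2\circ a_3)$, the Jacobi identity $[[a_1,a_2],a_3]+[[a_2,a_3],a_1]+[[a_3,a_1],a_2]=0$, and the Hertling–Manin relation $$\begin{aligned}[] [a_1\circ a_2,a_3\circ a_4]={}&[a_1\circ a_2,a_3]\circ a_4+[a_1\circ a_2,a_4]\circ a_3+a_1\circ[a_2,a_3\circ a_4]+a_2\circ[a_1,a_3\circ a_4]\\&-(a_1\circ a_3)\circ[a_2,a_4]-(a_2\circ a_3)\circ[a_1,a_4]-(a_2\circ a_4)\circ[a_1,a_3]-(a_1\circ a_4)\circ[a_2,a_3].\end{aligned}$$ Let $\mathrm{PL}$ be the operad of pre-Lie algebras: it is generated by a binary operation $\cdot$ without symmetries, subject to $(a_1\cdot a_2)\cdot a_3-a_1\cdot(a_2\cdot a_3)=(a_1\cdot a_3)\cdot a_2-a_1\cdot(a_3\cdot a_2)$. In $\mathrm{PL}$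 put $a_1\circ a_2=a_1\cdot a_2+a_2\cdot a_1$ and $[a_1,a_2]=a_1\cdot a_2-a_2\cdot a_1$. Let $F^\bullet\mathrm{PL}$ be the filtration of $\mathrm{PL}$ by powers of the ideal generated by $[-,-]$; that is, $F^n\mathrm{PL}$ is spanned by the tree tensors in which at least $n$ vertices are labelled by $[-,-]$. Let $\mathrm{gr}_F\mathrm{PL}=\bigoplus_{n\ge 0}F^n\mathrm{PL}/F^{n+1}\mathrm{PL}$ be the associated graded operad. Then: 1. There is a morphism of operads $\mathrm{FM}\to\mathrm{gr}_F\mathrm{PL}$ that is surjective on every component and that sends the generators $\circ$ and $[-,-]$ of $\mathrm{FM}$ to the coset of $\circ$ in $F^0\mathrm{PL}/F^1\mathrm{PL}$ and to the coset of $[-,-]$ in $F^1\mathrm{PL}/F^2\mathrm{PL}$, respectively. 2. These two cosets satisfy the associativity relation and the Hertling–Manin relation in $\mathrm{gr}_F\mathrm{PL}$. 3. The operations $\circ$ and $[-,-]$ generate the operad $\mathrm{PL}$. -/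

import Mathlib

universe u

/-! ## Symmetric operads, indexed by finite sets of inputs

A symmetric operad over a field `k`: a functor from finite sets and bijections to `k`-modules,
a unit, and partial compositions.  The component `P(n)` with its action of the symmetric group
is `P.obj (Fin n)` with `P.relabel`. -/

/-- `A ⊔ (B ⊔ {*}) ≃ (A ⊔ B) ⊔ {*}`. -/
def sumOptionEquiv (A B : Type) : A ⊕ Option B ≃ Option (A ⊕ B) where
  toFun
    | .inl a => some (.inl a)
    | .inr none => none
    | .inr (some b) => some (.inr b)
  invFun
    | none => .inr none
    | some (.inl a) => .inl a
    | some (.inr b) => .inr (some b)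
  left_inv := by rintro (a | _ | b) <;> rfl
  right_inv := by rintro (_ | a | b) <;> rfl

/-- `(A ⊔ {*}) ⊔ B ≃ (A ⊔ B) ⊔ {*}`. -/
def optionSumEquiv (A B : Type) : Option A ⊕ B ≃ Option (A ⊕ B) where
  toFun
    | .inl none => none
    | .inl (some a) => some (.inl a)
    | .inr b => some (.inr b)
  invFun
    | none => .inl none
    | some (.inl a) => .inl (some a)
    | some (.inr b) => .inr b
  left_inv := by rintro ((_ | a) | b) <;> rfl
  right_inv := by rintro (_ | a | b) <;> rfl

/-- Exchange of the two added points of `A ⊔ {*} ⊔ {*}`. -/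
def optionSwapEquiv (A : Type) : Option (Option A) ≃ Option (Option A) where
  toFun
    | none => some none
    | some none => none
    | some (some a) => some (some a)
  invFun
    | none => some none
    | some none => none
    | some (some a) => some (some a)
  left_inv := by rintro (_ | _ | a) <;> rfl
  right_inv := by rintro (_ | _ | a) <;> rfl

/-- `(A ⊔ B) ⊔ C ≃ (A ⊔ C) ⊔ B`. -/
def sumRightCommEquiv (A B C : Type) : (A ⊕ B) ⊕ C ≃ (A ⊕ C) ⊕ B where
  toFun
    | .inl (.inl a) => .inl (.inl a)
    | .inl (.inr b) => .inr b
    | .inr c => .inl (.inr c)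
  invFun
    | .inl (.inl a) => .inl (.inl a)
    | .inl (.inr c) => .inr c
    | .inr b => .inl (.inr b)
  left_inv := by rintro ((a | b) | c) <;> rfl
  right_inv := by rintro ((a | c) | b) <;> rfl

/-- The one-element set as `∅ ⊔ {*}`. -/
def unitOptionEquiv : Unit ≃ Option Empty where
  toFun _ := none
  invFun _ := ()
  left_inv _ := rfl
  right_inv := by rintro (_ | a) <;> [rfl; exact a.elim]

/-- A symmetric operad in `k`-modules.  `comp x y` is the partial composition `x ∘_* y`, which
inserts `y` into the input `* = none` of `x`. -/
structure SymmetricOperad (k : Type u) [Field k] where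
  obj : (A : Type) → [Finite A] → Type u
  [addCommGroup : ∀ (A : Type) [Finite A], AddCommGroup (obj A)]
  [module : ∀ (A : Type) [Finite A], Module k (obj A)]
  relabel : ∀ {A B : Type} [Finite A] [Finite B], A ≃ B → obj A →ₗ[k] obj B
  one : obj Unit
  comp : ∀ {A B : Type} [Finite A] [Finite B], obj (Option A) →ₗ[k] obj B →ₗ[k] obj (A ⊕ B)
  relabel_refl : ∀ {A : Type} [Finite A] (x : obj A), relabel (Equiv.refl A) x = x
  relabel_trans : ∀ {A B C : Type} [Finite A] [Finite B] [Finite C] (e : A ≃ B) (f : B ≃ C)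
    (x : obj A), relabel (e.trans f) x = relabel f (relabel e x)
  comp_relabel : ∀ {A A' B B' : Type} [Finite A] [Finite A'] [Finite B] [Finite B']
    (e : A ≃ A') (f : B ≃ B') (x : obj (Option A)) (y : obj B),
    comp (relabel (Equiv.optionCongr e) x) (relabel f y)
      = relabel (Equiv.sumCongr e f) (comp x y)
  one_comp : ∀ {B : Type} [Finite B] (y : obj B),
    comp (relabel unitOptionEquiv one) y = relabel (Equiv.emptySum Empty B).symm y
  comp_one : ∀ {A : Type} [Finite A] (x : obj (Option A)),
    comp x one = relabel (Equiv.optionEquivSumPUnit A) x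
  comp_assoc : ∀ {A B C : Type} [Finite A] [Finite B] [Finite C]
    (x : obj (Option A)) (y : obj (Option B)) (z : obj C),
    relabel (Equiv.sumAssoc A B C) (comp (relabel (sumOptionEquiv A B) (comp x y)) z)
      = comp x (comp y z)
  comp_comm : ∀ {A B C : Type} [Finite A] [Finite B] [Finite C]
    (x : obj (Option (Option A))) (y : obj B) (z : obj C),
    relabel (sumRightCommEquiv A B C) (comp (relabel (optionSumEquiv A B) (comp x y)) z)
      = comp (relabel (optionSumEquiv A C) (comp (relabel (optionSwapEquiv A) x) z)) y

attribute [instance] SymmetricOperad.addCommGroup SymmetricOperad.module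

namespace SymmetricOperad

variable {k : Type u} [Field k]

/-- Morphisms of operads. -/
structure Hom (P Q : SymmetricOperad k) where
  app : ∀ (A : Type) [Finite A], P.obj A →ₗ[k] Q.obj A
  map_relabel : ∀ {A B : Type} [Finite A] [Finite B] (e : A ≃ B) (x : P.obj A),
    app B (P.relabel e x) = Q.relabel e (app A x)
  map_one : app Unit P.one = Q.one
  map_comp : ∀ {A B : Type} [Finite A] [Finite B] (x : P.obj (Option A)) (y : P.obj B),
    app (A ⊕ B) (P.comp x y) = Q.comp (app (Option A) x) (app B y)

/-- A morphism of operads is a surjection if it is surjective on every component. -/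
def Hom.IsSurjective {P Q : SymmetricOperad k} (φ : Hom P Q) : Prop :=
  ∀ (A : Type) [Finite A], Function.Surjective (φ.app A)

/-- `x` belongs to the suboperad generated by the set `S` of operations. -/
inductive InSuboperad (P : SymmetricOperad k) (S : (n : ℕ) → Set (P.obj (Fin n))) :
    (A : Type) → [Finite A] → P.obj A → Prop
  | mem (n : ℕ) (x : P.obj (Fin n)) (hx : x ∈ S n) : InSuboperad P S (Fin n) x
  | one : InSuboperad P S Unit P.one
  | zero (A : Type) [Finite A] : InSuboperad P S A 0
  | add (A : Type) [Finite A] (x y : P.obj A) :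
      InSuboperad P S A x → InSuboperad P S A y → InSuboperad P S A (x + y)
  | smul (A : Type) [Finite A] (c : k) (x : P.obj A) :
      InSuboperad P S A x → InSuboperad P S A (c • x)
  | relabel (A B : Type) [Finite A] [Finite B] (e : A ≃ B) (x : P.obj A) :
      InSuboperad P S A x → InSuboperad P S B (P.relabel e x)
  | comp (A B : Type) [Finite A] [Finite B] (x : P.obj (Option A)) (y : P.obj B) :
      InSuboperad P S (Option A) x → InSuboperad P S B y →
      InSuboperad P S (A ⊕ B) (P.comp x y)

/-- The operad `P` is generated by the set `S` of operations. -/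
def IsGeneratedBy (P : SymmetricOperad k) (S : (n : ℕ) → Set (P.obj (Fin n))) : Prop :=
  ∀ (A : Type) [Finite A] (x : P.obj A), P.InSuboperad S A x

/-! ### Ideals and quotients -/

/-- Two-sided operadic ideals. -/
structure OperadIdeal (P : SymmetricOperad k) where
  carrier : (A : Type) → [Finite A] → Submodule k (P.obj A)
  relabel_mem : ∀ {A B : Type} [Finite A] [Finite B] (e : A ≃ B) (x : P.obj A),
    x ∈ carrier A → P.relabel e x ∈ carrier B
  comp_mem_left : ∀ {A B : Type} [Finite A] [Finite B] (x : P.obj (Option A)) (y : P.obj B),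
    x ∈ carrier (Option A) → P.comp x y ∈ carrier (A ⊕ B)
  comp_mem_right : ∀ {A B : Type} [Finite A] [Finite B] (x : P.obj (Option A)) (y : P.obj B),
    y ∈ carrier B → P.comp x y ∈ carrier (A ⊕ B)

/-- `x` belongs to the ideal generated by the set `R` of operations. -/
inductive InIdeal (P : SymmetricOperad k) (R : (n : ℕ) → P.obj (Fin n) → Prop) :
    (A : Type) → [Finite A] → P.obj A → Prop
  | mem (n : ℕ) (x : P.obj (Fin n)) (hx : R n x) : InIdeal P R (Fin n) x
  | zero (A : Type) [Finite A] : InIdeal P R A 0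
  | add (A : Type) [Finite A] (x y : P.obj A) :
      InIdeal P R A x → InIdeal P R A y → InIdeal P R A (x + y)
  | smul (A : Type) [Finite A] (c : k) (x : P.obj A) :
      InIdeal P R A x → InIdeal P R A (c • x)
  | relabel (A B : Type) [Finite A] [Finite B] (e : A ≃ B) (x : P.obj A) :
      InIdeal P R A x → InIdeal P R B (P.relabel e x)
  | comp_left (A B : Type) [Finite A] [Finite B] (x : P.obj (Option A)) (y : P.obj B) :
      InIdeal P R (Option A) x → InIdeal P R (A ⊕ B) (P.comp x y)
  | comp_right (A B : Type) [Finite A] [Finite B] (x : P.obj (Option A)) (y : P.obj B) :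
      InIdeal P R B y → InIdeal P R (A ⊕ B) (P.comp x y)

/-- The ideal generated by the set `R` of operations. -/
def idealSpan (P : SymmetricOperad k) (R : (n : ℕ) → P.obj (Fin n) → Prop) :
    OperadIdeal P where
  carrier A _ :=
    { carrier := {x | P.InIdeal R A x}
      add_mem' := fun {x y} hx hy => .add A x y hx hy
      zero_mem' := .zero A
      smul_mem' := fun c x hx => .smul A c x hx }
  relabel_mem e x hx := .relabel _ _ e x hx
  comp_mem_left x y hx := .comp_left _ _ x y hx
  comp_mem_right x y hy := .comp_right _ _ x y hy

/-- The composition induced on the quotient by an ideal. -/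
def quotientComp (P : SymmetricOperad k) (I : OperadIdeal P) (A B : Type) [Finite A] [Finite B] :
    (P.obj (Option A) ⧸ I.carrier (Option A)) →ₗ[k]
      (P.obj B ⧸ I.carrier B) →ₗ[k] (P.obj (A ⊕ B) ⧸ I.carrier (A ⊕ B)) :=
  Submodule.liftQ (I.carrier (Option A))
    (LinearMap.flip (Submodule.liftQ (I.carrier B)
      (LinearMap.flip (P.comp.compr₂ (I.carrier (A ⊕ B)).mkQ))
      (fun y hy => by
        rw [LinearMap.mem_ker]
        ext x
        exact (Submodule.Quotient.mk_eq_zero _).2 (I.comp_mem_right x y hy))))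
    (fun x hx => by
      rw [LinearMap.mem_ker]
      apply LinearMap.ext
      intro y
      obtain ⟨y, rfl⟩ := Submodule.mkQ_surjective _ y
      exact (Submodule.Quotient.mk_eq_zero _).2 (I.comp_mem_left x y hx))

/-- The quotient of an operad by an ideal. -/
def quotient (P : SymmetricOperad k) (I : OperadIdeal P) : SymmetricOperad k where
  obj A _ := P.obj A ⧸ I.carrier A
  relabel {A B} _ _ e := Submodule.mapQ (I.carrier A) (I.carrier B) (P.relabel e)
    (fun x hx => I.relabel_mem e x hx)
  one := Submodule.Quotient.mk P.one
  comp {A B} _ _ := P.quotientComp I A B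
  relabel_refl x := by
    obtain ⟨x, rfl⟩ := Submodule.Quotient.mk_surjective _ x
    exact congrArg Submodule.Quotient.mk (P.relabel_refl x)
  relabel_trans e f x := by
    obtain ⟨x, rfl⟩ := Submodule.Quotient.mk_surjective _ x
    exact congrArg Submodule.Quotient.mk (P.relabel_trans e f x)
  comp_relabel e f x y := by
    obtain ⟨x, rfl⟩ := Submodule.Quotient.mk_surjective _ x
    obtain ⟨y, rfl⟩ := Submodule.Quotient.mk_surjective _ y
    exact congrArg Submodule.Quotient.mk (P.comp_relabel e f x y)
  one_comp y := by
    obtain ⟨y, rfl⟩ := Submodule.Quotient.mk_surjective _ y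
    exact congrArg Submodule.Quotient.mk (P.one_comp y)
  comp_one x := by
    obtain ⟨x, rfl⟩ := Submodule.Quotient.mk_surjective _ x
    exact congrArg Submodule.Quotient.mk (P.comp_one x)
  comp_assoc x y z := by
    obtain ⟨x, rfl⟩ := Submodule.Quotient.mk_surjective _ x
    obtain ⟨y, rfl⟩ := Submodule.Quotient.mk_surjective _ y
    obtain ⟨z, rfl⟩ := Submodule.Quotient.mk_surjective _ z
    exact congrArg Submodule.Quotient.mk (P.comp_assoc x y z)
  comp_comm x y z := by
    obtain ⟨x, rfl⟩ := Submodule.Quotient.mk_surjective _ x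
    obtain ⟨y, rfl⟩ := Submodule.Quotient.mk_surjective _ y
    obtain ⟨z, rfl⟩ := Submodule.Quotient.mk_surjective _ z
    exact congrArg Submodule.Quotient.mk (P.comp_comm x y z)

/-- The class of an operation in the quotient operad. -/
def toQuotient (P : SymmetricOperad k) (I : OperadIdeal P) {A : Type} [Finite A] (x : P.obj A) :
    (P.quotient I).obj A :=
  (Submodule.Quotient.mk x : P.obj A ⧸ I.carrier A)

/-! ### Filtrations and associated graded operads -/

/-- Decreasing multiplicative filtrations of an operad. -/
structure OperadFiltration (P : SymmetricOperad k) where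
  level : ℕ → (A : Type) → [Finite A] → Submodule k (P.obj A)
  succ_le : ∀ (n : ℕ) (A : Type) [Finite A], level (n + 1) A ≤ level n A
  relabel_mem : ∀ (n : ℕ) {A B : Type} [Finite A] [Finite B] (e : A ≃ B) (x : P.obj A),
    x ∈ level n A → P.relabel e x ∈ level n B
  one_mem : P.one ∈ level 0 Unit
  comp_mem : ∀ (m n : ℕ) {A B : Type} [Finite A] [Finite B]
    (x : P.obj (Option A)) (y : P.obj B),
    x ∈ level m (Option A) → y ∈ level n B → P.comp x y ∈ level (m + n) (A ⊕ B)

namespace OperadFiltration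

variable {P : SymmetricOperad k} (F : OperadFiltration P)

/-- The graded piece `F^n P(A) / F^{n+1} P(A)`. -/
abbrev Piece (n : ℕ) (A : Type) [Finite A] : Type u :=
  F.level n A ⧸ (F.level (n + 1) A).submoduleOf (F.level n A)

/-- The component `⨁ₙ F^n P(A) / F^{n+1} P(A)` of the associated graded operad. -/
def GrObj (A : Type) [Finite A] : Type u := DirectSum ℕ (fun n => F.Piece n A)

instance grObjAddCommGroup (A : Type) [Finite A] : AddCommGroup (F.GrObj A) :=
  inferInstanceAs (AddCommGroup (DirectSum ℕ (fun n => F.Piece n A)))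

instance grObjModule (A : Type) [Finite A] : Module k (F.GrObj A) :=
  inferInstanceAs (Module k (DirectSum ℕ (fun n => F.Piece n A)))

/-- The inclusion of a graded piece. -/
def incl (n : ℕ) (A : Type) [Finite A] : F.Piece n A →ₗ[k] F.GrObj A :=
  DirectSum.lof k ℕ (fun n => F.Piece n A) n

/-- The linear map on the direct sum given by linear maps on the graded pieces. -/
def desc {A : Type} [Finite A] {M : Type u} [AddCommGroup M] [Module k M]
    (f : ∀ n, F.Piece n A →ₗ[k] M) : F.GrObj A →ₗ[k] M :=
  DirectSum.toModule k ℕ M f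

theorem desc_incl {A : Type} [Finite A] {M : Type u} [AddCommGroup M] [Module k M]
    (f : ∀ n, F.Piece n A →ₗ[k] M) (n : ℕ) (x : F.Piece n A) :
    F.desc f (F.incl n A x) = f n x :=
  DFinsupp.sumAddHom_single (fun n => (f n).toAddMonoidHom) n x

/-- The coset in `F^n P(A) / F^{n+1} P(A)` of an element of `F^n P(A)`, as a linear map into the
associated graded module. -/
def cls (n : ℕ) (A : Type) [Finite A] : F.level n A →ₗ[k] F.GrObj A :=
  (F.incl n A).comp
    ((F.level (n + 1) A).submoduleOf (F.level n A)).mkQ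

theorem cls_eq_zero {n : ℕ} {A : Type} [Finite A] (x : F.level n A)
    (hx : (x : P.obj A) ∈ F.level (n + 1) A) : F.cls n A x = 0 := by
  have h : ((F.level (n + 1) A).submoduleOf (F.level n A)).mkQ x = 0 :=
    (Submodule.Quotient.mk_eq_zero _).2 hx
  rw [cls, LinearMap.comp_apply, h, map_zero]

theorem cls_congr {m n : ℕ} {A : Type} [Finite A] (x y : P.obj A) (hx : x ∈ F.level m A)
    (hy : y ∈ F.level n A) (hmn : m = n) (hxy : x = y) :
    F.cls m A ⟨x, hx⟩ = F.cls n A ⟨y, hy⟩ := by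
  subst hmn; subst hxy; rfl

theorem grObj_induction {A : Type} [Finite A] {p : F.GrObj A → Prop} (x : F.GrObj A)
    (h0 : p 0) (hc : ∀ n (y : P.obj A) (hy : y ∈ F.level n A), p (F.cls n A ⟨y, hy⟩))
    (ha : ∀ y z, p y → p z → p (y + z)) : p x := by
  refine DirectSum.induction_on (motive := p) x h0 (fun n y => ?_) ha
  obtain ⟨⟨y, hy⟩, rfl⟩ := Submodule.Quotient.mk_surjective _ y
  exact hc n y hy

/-- The map `F^n P(A) → F^n P(B) / F^{n+1} P(B)` induced by a relabelling of inputs. -/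
def clsRelabel (n : ℕ) {A B : Type} [Finite A] [Finite B] (e : A ≃ B) :
    F.level n A →ₗ[k] F.GrObj B :=
  (F.cls n B).comp ((P.relabel e).restrict (fun x hx => F.relabel_mem n e x hx))

theorem le_ker_clsRelabel (n : ℕ) {A B : Type} [Finite A] [Finite B] (e : A ≃ B) :
    (F.level (n + 1) A).submoduleOf (F.level n A) ≤ LinearMap.ker (F.clsRelabel n e) := by
  intro x hx
  rw [LinearMap.mem_ker]
  exact F.cls_eq_zero _ (F.relabel_mem (n + 1) e x hx)

/-- Relabelling of inputs in the associated graded operad. -/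
def grRelabel {A B : Type} [Finite A] [Finite B] (e : A ≃ B) : F.GrObj A →ₗ[k] F.GrObj B :=
  F.desc (fun n =>
    Submodule.liftQ _ (F.clsRelabel n e) (F.le_ker_clsRelabel n e))

theorem grRelabel_cls {A B : Type} [Finite A] [Finite B] (e : A ≃ B) (n : ℕ) (x : P.obj A)
    (hx : x ∈ F.level n A) :
    F.grRelabel e (F.cls n A ⟨x, hx⟩) = F.cls n B ⟨P.relabel e x, F.relabel_mem n e x hx⟩ := by
  rw [grRelabel, cls, LinearMap.comp_apply, desc_incl]
  rfl

/-- The map `F^m P(A ⊔ {*}) × F^n P(B) → F^{m+n} P(A ⊔ B) / F^{m+n+1} P(A ⊔ B)`. -/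
def clsComp (m n : ℕ) (A B : Type) [Finite A] [Finite B] :
    F.level m (Option A) →ₗ[k] F.level n B →ₗ[k] F.GrObj (A ⊕ B) :=
  LinearMap.mk₂ k
    (fun x y => F.cls (m + n) (A ⊕ B) ⟨P.comp x.1 y.1, F.comp_mem m n x.1 y.1 x.2 y.2⟩)
    (fun x x' y => by
      rw [← map_add]; exact F.cls_congr _ _ _ _ rfl (by simp))
    (fun c x y => by
      rw [← map_smul]; exact F.cls_congr _ _ _ _ rfl (by simp))
    (fun x y y' => by
      rw [← map_add]; exact F.cls_congr _ _ _ _ rfl (by simp))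
    (fun c x y => by
      rw [← map_smul]; exact F.cls_congr _ _ _ _ rfl (by simp))

theorem le_ker_clsComp (m n : ℕ) (A B : Type) [Finite A] [Finite B] :
    (F.level (m + 1) (Option A)).submoduleOf (F.level m (Option A)) ≤
      LinearMap.ker (F.clsComp m n A B) := by
  intro x hx
  rw [LinearMap.mem_ker]
  apply LinearMap.ext
  intro y
  have h := F.comp_mem (m + 1) n x.1 y.1 hx y.2
  rw [Nat.add_right_comm] at h
  exact F.cls_eq_zero _ h

/-- The same map, on graded pieces in the first argument. -/
def leftPieceComp (m n : ℕ) (A B : Type) [Finite A] [Finite B] :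
    F.Piece m (Option A) →ₗ[k] F.level n B →ₗ[k] F.GrObj (A ⊕ B) :=
  Submodule.liftQ _ (F.clsComp m n A B) (F.le_ker_clsComp m n A B)

theorem le_ker_leftPieceComp (m n : ℕ) (A B : Type) [Finite A] [Finite B] :
    (F.level (n + 1) B).submoduleOf (F.level n B) ≤
      LinearMap.ker (F.leftPieceComp m n A B).flip := by
  intro y hy
  rw [LinearMap.mem_ker]
  apply LinearMap.ext
  intro x
  obtain ⟨x, rfl⟩ := Submodule.mkQ_surjective _ x
  exact F.cls_eq_zero _ (F.comp_mem m (n + 1) x.1 y.1 x.2 hy)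

/-- The same map, on graded pieces in both arguments. -/
def pieceComp (m n : ℕ) (A B : Type) [Finite A] [Finite B] :
    F.Piece n B →ₗ[k] F.Piece m (Option A) →ₗ[k] F.GrObj (A ⊕ B) :=
  Submodule.liftQ _ (F.leftPieceComp m n A B).flip (F.le_ker_leftPieceComp m n A B)

/-- Partial composition in the associated graded operad. -/
def grComp (A B : Type) [Finite A] [Finite B] :
    F.GrObj (Option A) →ₗ[k] F.GrObj B →ₗ[k] F.GrObj (A ⊕ B) :=
  F.desc (fun m =>
    LinearMap.flip (F.desc (fun n => F.pieceComp m n A B)))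

theorem grComp_cls {A B : Type} [Finite A] [Finite B] (m n : ℕ) (x : P.obj (Option A))
    (y : P.obj B) (hx : x ∈ F.level m (Option A)) (hy : y ∈ F.level n B) :
    F.grComp A B (F.cls m _ ⟨x, hx⟩) (F.cls n _ ⟨y, hy⟩)
      = F.cls (m + n) (A ⊕ B) ⟨P.comp x y, F.comp_mem m n x y hx hy⟩ := by
  rw [grComp, cls, LinearMap.comp_apply, desc_incl, LinearMap.flip_apply,
    cls, LinearMap.comp_apply, desc_incl]
  rfl

/-- The associated graded operad of a filtration. -/
def gr : SymmetricOperad k where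
  obj A _ := F.GrObj A
  relabel e := F.grRelabel e
  one := F.cls 0 Unit ⟨P.one, F.one_mem⟩
  comp {A B} _ _ := F.grComp A B
  relabel_refl x := by
    induction x using F.grObj_induction with
    | h0 => simp
    | hc n x hx => rw [grRelabel_cls]; exact F.cls_congr _ _ _ _ rfl (P.relabel_refl x)
    | ha x y hx hy => rw [map_add, hx, hy]
  relabel_trans e f x := by
    induction x using F.grObj_induction with
    | h0 => simp
    | hc n x hx =>
      simp only [grRelabel_cls]
      exact F.cls_congr _ _ _ _ rfl (P.relabel_trans e f x)
    | ha x y hx hy => simp only [map_add, hx, hy]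
  comp_relabel e f x y := by
    induction x using F.grObj_induction with
    | h0 => simp
    | ha x x' hx hx' => simp only [map_add, LinearMap.add_apply, hx, hx']
    | hc m x hx =>
    induction y using F.grObj_induction with
    | h0 => simp
    | ha y y' hy hy' => simp only [map_add, hy, hy']
    | hc n y hy =>
      simp only [grRelabel_cls, grComp_cls]
      exact F.cls_congr _ _ _ _ rfl (P.comp_relabel e f x y)
  one_comp y := by
    induction y using F.grObj_induction with
    | h0 => simp
    | ha y y' hy hy' => simp only [map_add, hy, hy']
    | hc n y hy =>
      simp only [grRelabel_cls, grComp_cls]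
      exact F.cls_congr _ _ _ _ (Nat.zero_add n) (P.one_comp y)
  comp_one x := by
    induction x using F.grObj_induction with
    | h0 => simp
    | ha x x' hx hx' => simp only [map_add, LinearMap.add_apply, hx, hx']
    | hc m x hx =>
      simp only [grRelabel_cls, grComp_cls]
      exact F.cls_congr _ _ _ _ rfl (P.comp_one x)
  comp_assoc x y z := by
    induction x using F.grObj_induction with
    | h0 => simp
    | ha x x' hx hx' => simp only [map_add, LinearMap.add_apply, hx, hx']
    | hc m x hx =>
    induction y using F.grObj_induction with
    | h0 => simp
    | ha y y' hy hy' => simp only [map_add, LinearMap.add_apply, hy, hy']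
    | hc n y hy =>
    induction z using F.grObj_induction with
    | h0 => simp
    | ha z z' hz hz' => simp only [map_add, hz, hz']
    | hc l z hz =>
      simp only [grRelabel_cls, grComp_cls]
      exact F.cls_congr _ _ _ _ (Nat.add_assoc m n l) (P.comp_assoc x y z)
  comp_comm x y z := by
    induction x using F.grObj_induction with
    | h0 => simp
    | ha x x' hx hx' => simp only [map_add, LinearMap.add_apply, hx, hx']
    | hc m x hx =>
    induction y using F.grObj_induction with
    | h0 => simp
    | ha y y' hy hy' => simp only [map_add, LinearMap.add_apply, hy, hy']
    | hc n y hy =>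
    induction z using F.grObj_induction with
    | h0 => simp
    | ha z z' hz hz' => simp only [map_add, LinearMap.add_apply, hz, hz']
    | hc l z hz =>
      simp only [grRelabel_cls, grComp_cls]
      exact F.cls_congr _ _ _ _ (Nat.add_right_comm m n l) (P.comp_comm x y z)

/-- The coset of `x ∈ F^n P(A)` in the component `F^n P(A) / F^{n+1} P(A)` of the associated
graded operad. -/
def toGr (n : ℕ) {A : Type} [Finite A] (x : P.obj A) (hx : x ∈ F.level n A) : F.gr.obj A :=
  F.cls n A ⟨x, hx⟩

end OperadFiltration

/-- `x` is a tree tensor in `P`, exactly `n` of whose vertices are marked as being labelled by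
elements of `S` (every other vertex carries an arbitrary element of `P`). -/
inductive IsTreeTensor (P : SymmetricOperad k) (S : (n : ℕ) → Set (P.obj (Fin n))) :
    ℕ → (A : Type) → [Finite A] → P.obj A → Prop
  | mem (n : ℕ) (x : P.obj (Fin n)) (hx : x ∈ S n) : IsTreeTensor P S 1 (Fin n) x
  | any (A : Type) [Finite A] (x : P.obj A) : IsTreeTensor P S 0 A x
  | relabel (n : ℕ) (A B : Type) [Finite A] [Finite B] (e : A ≃ B) (x : P.obj A) :
      IsTreeTensor P S n A x → IsTreeTensor P S n B (P.relabel e x)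
  | comp (m n : ℕ) (A B : Type) [Finite A] [Finite B] (x : P.obj (Option A)) (y : P.obj B) :
      IsTreeTensor P S m (Option A) x → IsTreeTensor P S n B y →
      IsTreeTensor P S (m + n) (A ⊕ B) (P.comp x y)

/-- The filtration by powers of the ideal generated by `S`: the `n`-th term is spanned by the tree
tensors in which at least `n` vertices are labelled by elements of `S`. -/
def powerFiltration (P : SymmetricOperad k) (S : (n : ℕ) → Set (P.obj (Fin n))) :
    OperadFiltration P where
  level n A _ := Submodule.span k {x | ∃ j, n ≤ j ∧ P.IsTreeTensor S j A x}
  succ_le n A _ := Submodule.span_mono (fun x ⟨j, hj, hx⟩ => ⟨j, by omega, hx⟩)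
  relabel_mem n A B _ _ e x hx := by
    induction hx using Submodule.span_induction with
    | mem x h =>
      obtain ⟨j, hj, h⟩ := h
      exact Submodule.subset_span ⟨j, hj, .relabel j A B e x h⟩
    | zero => rw [map_zero]; exact Submodule.zero_mem _
    | add x y _ _ hx hy => rw [map_add]; exact Submodule.add_mem _ hx hy
    | smul c x _ hx => rw [map_smul]; exact Submodule.smul_mem _ c hx
  one_mem := Submodule.subset_span ⟨0, le_refl 0, .any Unit P.one⟩
  comp_mem m n A B _ _ x y hx hy := by
    induction hx using Submodule.span_induction with
    | zero => rw [map_zero, LinearMap.zero_apply]; exact Submodule.zero_mem _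
    | add x y _ _ hx hy => rw [map_add, LinearMap.add_apply]; exact Submodule.add_mem _ hx hy
    | smul c x _ hx => rw [map_smul, LinearMap.smul_apply]; exact Submodule.smul_mem _ c hx
    | mem x h =>
    obtain ⟨i, hi, h⟩ := h
    induction hy using Submodule.span_induction with
    | zero => rw [map_zero]; exact Submodule.zero_mem _
    | add x y _ _ hx hy => rw [map_add]; exact Submodule.add_mem _ hx hy
    | smul c x _ hx => rw [map_smul]; exact Submodule.smul_mem _ c hx
    | mem y h' =>
      obtain ⟨j, hj, h'⟩ := h'
      exact Submodule.subset_span ⟨i + j, by omega, .comp i j A B x y h h'⟩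

end SymmetricOperad

/-! ## Free operads on binary operations -/

/-- Planar binary trees with vertices labelled by `G` and leaves labelled by `A`. -/
inductive BTree (G A : Type) : Type
  | leaf (a : A) : BTree G A
  | node (g : G) (s t : BTree G A) : BTree G A

namespace BTree

variable {G A B C : Type}

/-- The set of leaves of a tree. -/
def Pos : BTree G A → Type
  | leaf _ => Unit
  | node _ s t => s.Pos ⊕ t.Pos

/-- The label of a leaf. -/
def label : (t : BTree G A) → t.Pos → A
  | leaf a => fun _ => a
  | node _ s t => Sum.elim s.label t.label

instance finite_pos : (t : BTree G A) → Finite t.Pos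
  | leaf _ => inferInstanceAs (Finite Unit)
  | node _ s t =>
    haveI := finite_pos s
    haveI := finite_pos t
    inferInstanceAs (Finite (s.Pos ⊕ t.Pos))

/-- A tree is multilinear if every element of `A` labels exactly one leaf. -/
abbrev IsMultilinear (t : BTree G A) : Prop := Function.Bijective t.label

/-- Replacement of each leaf labelled `a` by the tree `f a`. -/
def bind : BTree G A → (A → BTree G B) → BTree G B
  | leaf a, f => f a
  | node g s t, f => node g (s.bind f) (t.bind f)

theorem bind_leaf (t : BTree G A) : t.bind leaf = t := by
  induction t with
  | leaf a => rfl
  | node g s t hs ht => rw [bind, hs, ht]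

theorem bind_bind (t : BTree G A) (f : A → BTree G B) (g : B → BTree G C) :
    (t.bind f).bind g = t.bind (fun a => (f a).bind g) := by
  induction t with
  | leaf a => rfl
  | node c s t hs ht => rw [bind, bind, hs, ht, bind]

/-- The leaves of the tree obtained by substitution. -/
def posBind (f : A → BTree G B) : (t : BTree G A) →
    (t.bind f).Pos ≃ Σ p : t.Pos, (f (t.label p)).Pos
  | leaf a => (Equiv.uniqueSigma (fun _ : Unit => (f a).Pos)).symm
  | node _ s t => (Equiv.sumCongr (posBind f s) (posBind f t)).trans
      (Equiv.sumSigmaDistrib (fun p : s.Pos ⊕ t.Pos =>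
        (f (Sum.elim s.label t.label p)).Pos)).symm

theorem label_posBind_symm (f : A → BTree G B) (t : BTree G A) (p : t.Pos)
    (q : (f (t.label p)).Pos) :
    (t.bind f).label ((posBind f t).symm ⟨p, q⟩) = (f (t.label p)).label q := by
  induction t with
  | leaf a => rfl
  | node g s t hs ht =>
    rcases p with p | p
    · exact hs p q
    · exact ht p q

theorem IsMultilinear.bind {t : BTree G A} (ht : t.IsMultilinear) (f : A → BTree G B)
    (hf : Function.Bijective (fun x : Σ a, (f a).Pos => (f x.1).label x.2)) :
    (t.bind f).IsMultilinear := by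
  have h : (t.bind f).label ∘ (posBind f t).symm
      = (fun x : Σ a, (f a).Pos => (f x.1).label x.2) ∘
        (Equiv.sigmaCongrLeft (β := fun a => (f a).Pos) (Equiv.ofBijective t.label ht)) := by
    funext ⟨p, q⟩
    exact label_posBind_symm f t p q
  have h2 : Function.Bijective ((t.bind f).label ∘ (posBind f t).symm) := by
    rw [h]; exact hf.comp (Equiv.bijective _)
  exact (Function.Bijective.of_comp_iff _ (posBind f t).symm.bijective).1 h2

end BTree

/-- The tree monomials with set of inputs `A`: planar binary trees with vertices labelled by `G`
and leaves labelled bijectively by `A`. -/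
abbrev TreeMonomial (G A : Type) : Type := {t : BTree G A // t.IsMultilinear}

namespace TreeMonomial

variable {G A B C : Type}

/-- Relabelling of leaves. -/
def relabel (e : A ≃ B) (t : TreeMonomial G A) : TreeMonomial G B :=
  ⟨t.1.bind (fun a => .leaf (e a)), t.2.bind _ <| by
    refine ⟨?_, fun b => ⟨⟨e.symm b, ()⟩, e.apply_symm_apply b⟩⟩
    rintro ⟨a, ⟨⟩⟩ ⟨a', ⟨⟩⟩ h
    obtain rfl : a = a' := e.injective h
    rfl⟩

/-- The one-leaf tree. -/
def one : TreeMonomial G Unit :=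
  ⟨.leaf (), ⟨fun _ _ _ => rfl, fun _ => ⟨(), rfl⟩⟩⟩

/-- The trees that are grafted by `graft`. -/
def graftMap (y : BTree G B) : Option A → BTree G (A ⊕ B)
  | none => y.bind (fun b => .leaf (.inr b))
  | some a => .leaf (.inl a)

/-- Grafting of `y` at the leaf `*` of `x`. -/
def graft (x : TreeMonomial G (Option A)) (y : TreeMonomial G B) : TreeMonomial G (A ⊕ B) :=
  ⟨x.1.bind (graftMap y.1), x.2.bind _ <| by
    let ι : B → BTree G (A ⊕ B) := fun b => .leaf (.inr b)
    let pos : y.1.Pos → (y.1.bind ι).Pos := fun q => (BTree.posBind ι y.1).symm ⟨q, ()⟩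
    have key : ∀ p : (y.1.bind ι).Pos, ∃ q : y.1.Pos, p = pos q := by
      intro p
      refine ⟨(BTree.posBind ι y.1 p).1, ?_⟩
      rw [Equiv.eq_symm_apply]
      rfl
    have hpos : ∀ q : y.1.Pos, (y.1.bind ι).label (pos q) = Sum.inr (y.1.label q) :=
      fun q => BTree.label_posBind_symm ι y.1 q ()
    constructor
    · rintro ⟨_ | a, p⟩ ⟨_ | a', p'⟩ h
      · obtain ⟨q, rfl⟩ := key p
        obtain ⟨q', rfl⟩ := key p'
        have h' : (Sum.inr (y.1.label q) : A ⊕ B) = Sum.inr (y.1.label q') :=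
          ((hpos q).symm.trans h).trans (hpos q')
        obtain rfl : q = q' := y.2.1 (Sum.inr_injective h')
        rfl
      · obtain ⟨q, rfl⟩ := key p
        have h' : (Sum.inr (y.1.label q) : A ⊕ B) = Sum.inl a' := (hpos q).symm.trans h
        cases h'
      · obtain ⟨q', rfl⟩ := key p'
        have h' : (Sum.inl a : A ⊕ B) = Sum.inr (y.1.label q') := h.trans (hpos q')
        cases h'
      · obtain rfl : a = a' := Sum.inl_injective h
        rfl
    · rintro (a | b)
      · exact ⟨⟨some a, ()⟩, rfl⟩
      · obtain ⟨q, rfl⟩ := y.2.2 b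
        exact ⟨⟨none, pos q⟩, hpos q⟩⟩

/-- The tree with one vertex `g` and leaves `0`, `1` from left to right. -/
def corolla (g : G) : TreeMonomial G (Fin 2) :=
  ⟨.node g (.leaf 0) (.leaf 1), by
    constructor
    · rintro (⟨⟩ | ⟨⟩) (⟨⟩ | ⟨⟩) h
      · rfl
      · exact absurd (show (0 : Fin 2) = 1 from h) (by decide)
      · exact absurd (show (1 : Fin 2) = 0 from h) (by decide)
      · rfl
    · intro i
      fin_cases i
      · exact ⟨Sum.inl (), rfl⟩
      · exact ⟨Sum.inr (), rfl⟩⟩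

end TreeMonomial

namespace SymmetricOperad

variable (k : Type u) [Field k]

open TreeMonomial in
/-- The free operad on a set `G` of binary operations without symmetries: the linear combinations
of tree monomials. -/
noncomputable def free (G : Type) : SymmetricOperad k where
  obj A _ := TreeMonomial G A →₀ k
  relabel e := Finsupp.lmapDomain k k (TreeMonomial.relabel e)
  one := Finsupp.single TreeMonomial.one 1
  comp := Finsupp.linearCombination k (fun x => Finsupp.lmapDomain k k (graft x))
  relabel_refl {A} _ x := by
    have h : (TreeMonomial.relabel (Equiv.refl A) : TreeMonomial G A → TreeMonomial G A) = id := by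
      funext t
      exact Subtype.ext t.1.bind_leaf
    change Finsupp.mapDomain _ x = x
    rw [h]
    exact Finsupp.mapDomain_id
  relabel_trans {A B C} _ _ _ e f x := by
    have h : (TreeMonomial.relabel (e.trans f) : TreeMonomial G A → TreeMonomial G C)
        = TreeMonomial.relabel f ∘ TreeMonomial.relabel e := by
      funext t
      exact Subtype.ext (BTree.bind_bind t.1 (fun a => .leaf (e a)) (fun b => .leaf (f b))).symm
    change Finsupp.mapDomain _ x = Finsupp.mapDomain _ (Finsupp.mapDomain _ x)
    rw [h]
    exact Finsupp.mapDomain_comp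
  comp_relabel e f x y := by
    induction x using Finsupp.induction_linear with
    | zero => simp
    | add x x' hx hx' => simp only [map_add, LinearMap.add_apply, hx, hx']
    | single s a =>
    induction y using Finsupp.induction_linear with
    | zero => simp
    | add y y' hy hy' => simp only [map_add, hy, hy']
    | single t b =>
      simp only [Finsupp.lmapDomain_apply, Finsupp.mapDomain_single,
        Finsupp.linearCombination_single, LinearMap.smul_apply, Finsupp.smul_single]
      congr 1
      apply Subtype.ext
      simp only [TreeMonomial.relabel, graft, BTree.bind_bind]
      congr 1
      funext o
      rcases o with _ | o
      · simp only [BTree.bind, graftMap, BTree.bind_bind, Equiv.optionCongr_apply, Option.map]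
        rfl
      · rfl
  one_comp y := by
    induction y using Finsupp.induction_linear with
    | zero => simp
    | add y y' hy hy' => simp only [map_add, hy, hy']
    | single t b =>
      simp only [Finsupp.lmapDomain_apply, Finsupp.mapDomain_single,
        Finsupp.linearCombination_single, one_smul]
      rfl
  comp_one x := by
    induction x using Finsupp.induction_linear with
    | zero => simp
    | add x x' hx hx' => simp only [map_add, LinearMap.add_apply, hx, hx']
    | single s a =>
      simp only [Finsupp.lmapDomain_apply, Finsupp.mapDomain_single,
        Finsupp.linearCombination_single, LinearMap.smul_apply, Finsupp.smul_single,
        smul_eq_mul, mul_one]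
      congr 1
      apply Subtype.ext
      simp only [TreeMonomial.relabel, graft]
      congr 1
      funext o
      rcases o with _ | o <;> rfl
  comp_assoc x y z := by
    induction x using Finsupp.induction_linear with
    | zero => simp
    | add x x' hx hx' => simp only [map_add, LinearMap.add_apply, hx, hx']
    | single s a =>
    induction y using Finsupp.induction_linear with
    | zero => simp
    | add y y' hy hy' => simp only [map_add, LinearMap.add_apply, hy, hy']
    | single t b =>
    induction z using Finsupp.induction_linear with
    | zero => simp
    | add z z' hz hz' => simp only [map_add, hz, hz']
    | single r c =>
      simp only [Finsupp.lmapDomain_apply, Finsupp.mapDomain_single,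
        Finsupp.linearCombination_single, LinearMap.smul_apply, Finsupp.smul_single,
        smul_eq_mul, mul_assoc]
      congr 1
      apply Subtype.ext
      simp only [TreeMonomial.relabel, graft, BTree.bind_bind]
      congr 1
      funext o
      rcases o with _ | o
      · simp only [graftMap, BTree.bind_bind]
        congr 1
        funext o
        rcases o with _ | o
        · simp only [BTree.bind, sumOptionEquiv, Equiv.coe_fn_mk, BTree.bind_bind]
          rfl
        · rfl
      · rfl
  comp_comm x y z := by
    induction x using Finsupp.induction_linear with
    | zero => simp
    | add x x' hx hx' => simp only [map_add, LinearMap.add_apply, hx, hx']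
    | single s a =>
    induction y using Finsupp.induction_linear with
    | zero => simp
    | add y y' hy hy' => simp only [map_add, LinearMap.add_apply, hy, hy']
    | single t b =>
    induction z using Finsupp.induction_linear with
    | zero => simp
    | add z z' hz hz' => simp only [map_add, LinearMap.add_apply, hz, hz']
    | single r c =>
      simp only [Finsupp.lmapDomain_apply, Finsupp.mapDomain_single,
        Finsupp.linearCombination_single, LinearMap.smul_apply, Finsupp.smul_single,
        smul_eq_mul]
      congr 1
      · apply Subtype.ext
        simp only [TreeMonomial.relabel, graft, BTree.bind_bind]
        congr 1
        funext o
        rcases o with _ | _ | o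
        · simp only [graftMap, BTree.bind_bind]
          rfl
        · simp only [graftMap, BTree.bind, optionSumEquiv, optionSwapEquiv, Equiv.coe_fn_mk,
            BTree.bind_bind]
          rfl
        · rfl
      · ring

/-- The generator of the free operad that corresponds to `g`. -/
noncomputable def freeGen {G : Type} (g : G) : (free k G).obj (Fin 2) :=
  (Finsupp.single (TreeMonomial.corolla g) 1 : TreeMonomial G (Fin 2) →₀ k)

variable {k}

/-! ## Evaluation of monomials -/

/-- `{*} ⊔ {1} ≃ {0, 1}`, where `*` goes to `0`. -/
def finTwoOptionEquiv : Fin 2 ≃ Option Unit where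
  toFun i := if i = 0 then none else some ()
  invFun
    | none => 0
    | some _ => 1
  left_inv := by decide
  right_inv := by decide

/-- The operation `μ(x, y)`, for a binary operation `μ`. -/
def bin (P : SymmetricOperad k) (μ : P.obj (Fin 2)) {A B : Type} [Finite A] [Finite B]
    (x : P.obj A) (y : P.obj B) : P.obj (A ⊕ B) :=
  P.comp (P.relabel ((Equiv.sumComm Unit A).trans (Equiv.optionEquivSumPUnit A).symm)
    (P.comp (P.relabel finTwoOptionEquiv μ) x)) y

/-- The composite of binary operations along a tree; its inputs are the leaves of the tree. -/
def evalPos (P : SymmetricOperad k) {G A : Type} (μ : G → P.obj (Fin 2)) :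
    (t : BTree G A) → P.obj t.Pos
  | .leaf _ => P.one
  | .node g s t => P.bin (μ g) (P.evalPos μ s) (P.evalPos μ t)

open Classical in
/-- The operation given by a multilinear monomial, such as `(a₁ ∘ a₂) ∘ a₃`, in the binary
operations `μ` (set to `0` if the monomial is not multilinear). -/
noncomputable def eval (P : SymmetricOperad k) {G A : Type} [Finite A] (μ : G → P.obj (Fin 2))
    (t : BTree G A) : P.obj A :=
  if h : t.IsMultilinear then P.relabel (Equiv.ofBijective t.label h) (P.evalPos μ t) else 0

/-- The opposite `μ(a₂, a₁)` of a binary operation `μ(a₁, a₂)`. -/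
def opp (P : SymmetricOperad k) (μ : P.obj (Fin 2)) : P.obj (Fin 2) :=
  P.relabel (Equiv.swap 0 1) μ

/-! ## The operad of pre-Lie algebras -/

/-- The difference of the two sides of
`(a₁·a₂)·a₃ - a₁·(a₂·a₃) = (a₁·a₃)·a₂ - a₁·(a₃·a₂)`. -/
noncomputable def preLieRelator (P : SymmetricOperad k) (p : P.obj (Fin 2)) : P.obj (Fin 3) :=
  let E : BTree Unit (Fin 3) → P.obj (Fin 3) := P.eval (fun _ => p)
  let m : BTree Unit (Fin 3) → BTree Unit (Fin 3) → BTree Unit (Fin 3) := .node ()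
  let a₁ : BTree Unit (Fin 3) := .leaf 0
  let a₂ : BTree Unit (Fin 3) := .leaf 1
  let a₃ : BTree Unit (Fin 3) := .leaf 2
  (E (m (m a₁ a₂) a₃) - E (m a₁ (m a₂ a₃))) - (E (m (m a₁ a₃) a₂) - E (m a₁ (m a₃ a₂)))

variable (k) in
/-- The defining relation of the pre-Lie operad. -/
inductive PreLieRelation : (n : ℕ) → (free k Unit).obj (Fin n) → Prop
  | preLie : PreLieRelation 3 (preLieRelator (free k Unit) (freeGen k ()))

variable (k) in
/-- The operad of pre-Lie algebras, generated by a binary operation without symmetries. -/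
noncomputable def PreLie : SymmetricOperad k :=
  (free k Unit).quotient ((free k Unit).idealSpan (PreLieRelation k))

variable (k) in
/-- The pre-Lie product `a₁·a₂`. -/
noncomputable def preLieProduct : (PreLie k).obj (Fin 2) :=
  (free k Unit).toQuotient _ (freeGen k ())

variable (k) in
/-- The symmetrised product `a₁ ∘ a₂ = a₁·a₂ + a₂·a₁`. -/
noncomputable def symProduct : (PreLie k).obj (Fin 2) :=
  preLieProduct k + (PreLie k).opp (preLieProduct k)

variable (k) in
/-- The bracket `[a₁, a₂] = a₁·a₂ - a₂·a₁`. -/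
noncomputable def lieBracket : (PreLie k).obj (Fin 2) :=
  preLieProduct k - (PreLie k).opp (preLieProduct k)

/-- The set of operations whose only element is the binary operation `μ`. -/
inductive BinarySingleton (P : SymmetricOperad k) (μ : P.obj (Fin 2)) :
    (n : ℕ) → P.obj (Fin n) → Prop
  | self : BinarySingleton P μ 2 μ

/-- The set of operations whose only elements are the binary operations `μ` and `ν`. -/
inductive BinaryPair (P : SymmetricOperad k) (μ ν : P.obj (Fin 2)) :
    (n : ℕ) → P.obj (Fin n) → Prop
  | left : BinaryPair P μ ν 2 μ
  | right : BinaryPair P μ ν 2 ν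

variable (k) in
/-- The Lie filtration of the pre-Lie operad, by powers of the ideal generated by the bracket. -/
noncomputable def lieFiltration : OperadFiltration (PreLie k) :=
  (PreLie k).powerFiltration (fun n => {x | BinarySingleton (PreLie k) (lieBracket k) n x})

variable (k) in
/-- The coset of the symmetrised product in `F⁰/F¹`. -/
noncomputable def grSymProduct : (lieFiltration k).gr.obj (Fin 2) :=
  (lieFiltration k).toGr 0 (symProduct k)
    (Submodule.subset_span ⟨0, le_refl 0, .any (Fin 2) (symProduct k)⟩)

variable (k) in
/-- The coset of the bracket in `F¹/F²`. -/
noncomputable def grLieBracket : (lieFiltration k).gr.obj (Fin 2) :=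
  (lieFiltration k).toGr 1 (lieBracket k)
    (Submodule.subset_span ⟨1, le_refl 1, .mem 2 (lieBracket k) .self⟩)

/-! ## The operad of F-manifold algebras -/

/-- The two generating operations: the product `∘` and the bracket `[-,-]`. -/
inductive FManGen : Type
  | prod : FManGen
  | bracket : FManGen

/-- Substitution of operations `c`, `l` for the product and the bracket. -/
def fManSubst (P : SymmetricOperad k) (c l : P.obj (Fin 2)) : FManGen → P.obj (Fin 2)
  | .prod => c
  | .bracket => l

/-- The difference of the two sides of `(a₁ ∘ a₂) ∘ a₃ = a₁ ∘ (a₂ ∘ a₃)`. -/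
noncomputable def associativityRelator (P : SymmetricOperad k) (c : P.obj (Fin 2)) :
    P.obj (Fin 3) :=
  let E : BTree Unit (Fin 3) → P.obj (Fin 3) := P.eval (fun _ => c)
  let m : BTree Unit (Fin 3) → BTree Unit (Fin 3) → BTree Unit (Fin 3) := .node ()
  let a₁ : BTree Unit (Fin 3) := .leaf 0
  let a₂ : BTree Unit (Fin 3) := .leaf 1
  let a₃ : BTree Unit (Fin 3) := .leaf 2
  E (m (m a₁ a₂) a₃) - E (m a₁ (m a₂ a₃))

/-- The sum `[[a₁,a₂],a₃] + [[a₂,a₃],a₁] + [[a₃,a₁],a₂]`. -/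
noncomputable def jacobiRelator (P : SymmetricOperad k) (l : P.obj (Fin 2)) : P.obj (Fin 3) :=
  let E : BTree Unit (Fin 3) → P.obj (Fin 3) := P.eval (fun _ => l)
  let b : BTree Unit (Fin 3) → BTree Unit (Fin 3) → BTree Unit (Fin 3) := .node ()
  let a₁ : BTree Unit (Fin 3) := .leaf 0
  let a₂ : BTree Unit (Fin 3) := .leaf 1
  let a₃ : BTree Unit (Fin 3) := .leaf 2
  E (b (b a₁ a₂) a₃) + E (b (b a₂ a₃) a₁) + E (b (b a₃ a₁) a₂)

/-- The difference of the two sides of the Hertling–Manin relation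
`[a₁∘a₂, a₃∘a₄] = [a₁∘a₂,a₃]∘a₄ + [a₁∘a₂,a₄]∘a₃ + a₁∘[a₂,a₃∘a₄] + a₂∘[a₁,a₃∘a₄]
  - (a₁∘a₃)∘[a₂,a₄] - (a₂∘a₃)∘[a₁,a₄] - (a₂∘a₄)∘[a₁,a₃] - (a₁∘a₄)∘[a₂,a₃]`. -/
noncomputable def hertlingManinRelator (P : SymmetricOperad k) (c l : P.obj (Fin 2)) :
    P.obj (Fin 4) :=
  let E : BTree FManGen (Fin 4) → P.obj (Fin 4) := P.eval (P.fManSubst c l)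
  let m : BTree FManGen (Fin 4) → BTree FManGen (Fin 4) → BTree FManGen (Fin 4) := .node .prod
  let b : BTree FManGen (Fin 4) → BTree FManGen (Fin 4) → BTree FManGen (Fin 4) := .node .bracket
  let a₁ : BTree FManGen (Fin 4) := .leaf 0
  let a₂ : BTree FManGen (Fin 4) := .leaf 1
  let a₃ : BTree FManGen (Fin 4) := .leaf 2
  let a₄ : BTree FManGen (Fin 4) := .leaf 3
  E (b (m a₁ a₂) (m a₃ a₄)) -
    (E (m (b (m a₁ a₂) a₃) a₄) + E (m (b (m a₁ a₂) a₄) a₃)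
      + E (m a₁ (b a₂ (m a₃ a₄))) + E (m a₂ (b a₁ (m a₃ a₄)))
      - E (m (m a₁ a₃) (b a₂ a₄)) - E (m (m a₂ a₃) (b a₁ a₄))
      - E (m (m a₂ a₄) (b a₁ a₃)) - E (m (m a₁ a₄) (b a₂ a₃)))

variable (k) in
/-- The defining relations of the operad of F-manifold algebras. -/
inductive FManRelation : (n : ℕ) → (free k FManGen).obj (Fin n) → Prop
  | symm : FManRelation 2
      ((free k FManGen).opp (freeGen k .prod) - freeGen k .prod)
  | skew : FManRelation 2
      ((free k FManGen).opp (freeGen k .bracket) + freeGen k .bracket)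
  | assoc : FManRelation 3 ((free k FManGen).associativityRelator (freeGen k .prod))
  | jacobi : FManRelation 3 ((free k FManGen).jacobiRelator (freeGen k .bracket))
  | hertlingManin : FManRelation 4
      ((free k FManGen).hertlingManinRelator (freeGen k .prod) (freeGen k .bracket))

variable (k) in
/-- The operad of F-manifold algebras. -/
noncomputable def FMan : SymmetricOperad k :=
  (free k FManGen).quotient ((free k FManGen).idealSpan (FManRelation k))

variable (k) in
/-- The product `∘` and the bracket `[-,-]` in the operad of F-manifold algebras. -/
noncomputable def fManOp (g : FManGen) : (FMan k).obj (Fin 2) :=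
  (free k FManGen).toQuotient _ (freeGen k g)

end SymmetricOperad

namespace SymmetricOperad

variable {k : Type u} [Field k]

/-! ## Binary composites in an operad -/

/-! The heart of the matter is a computation in a filtered pre-Lie algebra. Write (x,y,z) = (x·y)·z
− x·(y·z). The pre-Lie relation gives (x,y,z) = [x,y]·z + y·[x,z] − [x, y·z], so an associator lies
one step deeper in the filtration than its arguments together (`associator_mem`); hence ∘ is
associative modulo F¹ (`anticommutator_associator_mem`). It also gives [x, y∘z] − [x,y]∘z − y∘[x,z]
= −2(x,y,z) (`leibniz_mem`). The Hertling–Manin relation says that this Leibniz defect is a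
derivation in its first argument with respect to ∘. This holds modulo F² because the associator has
that property (`associator_mul_mem`), and `hertlingManin_mem` assembles the pieces.

These identities concern elements of an algebra, whereas the relators live in an operad. The bridge
is the free nonassociative algebra on a finite set, spanned by binary trees with arbitrary, possibly
repeated, leaves. The filtration of PL induces one on it (`treeFiltration`), for which the pre-Lie
relation holds modulo every term (`isPreLieFiltration_treeFiltration`). Taking multilinear parts
returns to F^n PL (`preLieProj_multilinearPart_mem`). The associativity, Jacobi and Hertling–Manin
relators thus fall one level deeper than their degree and vanish in the graded operad; with the
symmetries of the two operations, the universal properties of free operads and quotients then give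
the morphism `fManHom`.

For surjectivity, a·b = ½(a∘b + [a,b]), so ∘ and [-,-] generate PL. The bracket vanishes in F⁰/F¹,
so F⁰/F¹ is generated by ∘. The coset of a tree tensor with n marked vertices is a composite of
cosets from F⁰/F¹ and n copies of the coset of the bracket, and such cosets span F^n/F^{n+1}. -/

theorem relabel_relabel (P : SymmetricOperad k) {A B C : Type} [Finite A] [Finite B] [Finite C]
    (e : A ≃ B) (f : B ≃ C) (x : P.obj A) :
    P.relabel f (P.relabel e x) = P.relabel (e.trans f) x :=
  (P.relabel_trans e f x).symm

theorem relabel_congr (P : SymmetricOperad k) {A B : Type} [Finite A] [Finite B] {e f : A ≃ B}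
    (h : ∀ a, e a = f a) (x : P.obj A) : P.relabel e x = P.relabel f x := by
  rw [Equiv.ext h]

theorem comp_relabel_left (P : SymmetricOperad k) {A A' B : Type} [Finite A] [Finite A']
    [Finite B] (e : A ≃ A') (x : P.obj (Option A)) (y : P.obj B) :
    P.comp (P.relabel (Equiv.optionCongr e) x) y
      = P.relabel (Equiv.sumCongr e (Equiv.refl B)) (P.comp x y) := by
  rw [← P.comp_relabel, P.relabel_refl]

theorem comp_relabel_right (P : SymmetricOperad k) {A B B' : Type} [Finite A] [Finite B]
    [Finite B'] (f : B ≃ B') (x : P.obj (Option A)) (y : P.obj B) :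
    P.comp x (P.relabel f y) = P.relabel (Equiv.sumCongr (Equiv.refl A) f) (P.comp x y) := by
  rw [← P.comp_relabel, Equiv.optionCongr_refl, P.relabel_refl]

theorem bin_relabel (P : SymmetricOperad k) (μ : P.obj (Fin 2)) {A A' B B' : Type} [Finite A]
    [Finite A'] [Finite B] [Finite B'] (e : A ≃ A') (f : B ≃ B') (x : P.obj A) (y : P.obj B) :
    P.bin μ (P.relabel e x) (P.relabel f y)
      = P.relabel (Equiv.sumCongr e f) (P.bin μ x y) := by
  rw [bin, comp_relabel_right P e, relabel_relabel, bin, ← P.comp_relabel, relabel_relabel]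
  refine congrArg (fun z => P.comp z (P.relabel f y)) (P.relabel_congr ?_ _)
  rintro (a | a) <;> rfl

theorem comp_bin_right (P : SymmetricOperad k) (μ : P.obj (Fin 2)) {A B C : Type} [Finite A]
    [Finite B] [Finite C] (z : P.obj C) (x : P.obj (Option A)) (y : P.obj B) :
    P.comp (P.relabel (sumOptionEquiv C A) (P.bin μ z x)) y
      = P.relabel (Equiv.sumAssoc C A B).symm (P.bin μ z (P.comp x y)) := by
  rw [bin, bin, ← P.comp_assoc, relabel_relabel, Equiv.self_trans_symm, P.relabel_refl]

/-- In `bin` the left argument is inserted before the right one. An insertion into the left argument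
must therefore pass the insertion of `z` by `comp_comm`, and then enter the inner composite by
`comp_assoc`. -/
theorem comp_bin_left (P : SymmetricOperad k) (μ : P.obj (Fin 2)) {A B C : Type} [Finite A]
    [Finite B] [Finite C] (x : P.obj (Option A)) (z : P.obj C) (y : P.obj B) :
    P.comp (P.relabel (optionSumEquiv A C) (P.bin μ x z)) y
      = P.relabel (sumRightCommEquiv A B C) (P.bin μ (P.comp x y) z) := by
  obtain ⟨X, hX⟩ : ∃ X, X = P.relabel ((Equiv.sumComm Unit (Option A)).trans
    (Equiv.optionEquivSumPUnit (Option A)).symm) (P.comp (P.relabel finTwoOptionEquiv μ) x) :=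
    ⟨_, rfl⟩
  have h := P.comp_comm (P.relabel (optionSwapEquiv A) X) y z
  rw [relabel_relabel, show (optionSwapEquiv A).trans (optionSwapEquiv A) = Equiv.refl _ by
    ext1 a; rcases a with _ | _ | a <;> rfl, P.relabel_refl] at h
  have h2 : P.relabel (optionSwapEquiv A) X
      = P.relabel (Equiv.optionCongr ((Equiv.sumComm Unit A).trans
          (Equiv.optionEquivSumPUnit A).symm))
        (P.relabel (sumOptionEquiv Unit A) (P.comp (P.relabel finTwoOptionEquiv μ) x)) := by
    rw [hX, relabel_relabel, relabel_relabel]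
    refine P.relabel_congr ?_ _
    rintro (a | _ | a) <;> rfl
  have h3 : P.relabel (optionSumEquiv A B) (P.comp (P.relabel (optionSwapEquiv A) X) y)
      = P.relabel ((Equiv.sumComm Unit (A ⊕ B)).trans (Equiv.optionEquivSumPUnit (A ⊕ B)).symm)
        (P.comp (P.relabel finTwoOptionEquiv μ) (P.comp x y)) := by
    rw [h2, comp_relabel_left, ← P.comp_assoc, relabel_relabel, relabel_relabel]
    refine P.relabel_congr ?_ _
    rintro ((a | a) | a) <;> rfl
  rw [bin, ← hX, ← h, bin, h3]

theorem bin_one_one (P : SymmetricOperad k) (μ : P.obj (Fin 2)) (e : Unit ⊕ Unit ≃ Fin 2)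
    (h0 : e (.inl ()) = 0) (h1 : e (.inr ()) = 1) :
    P.relabel e (P.bin μ P.one P.one) = μ := by
  rw [bin, comp_one, comp_one, relabel_relabel, relabel_relabel, relabel_relabel, relabel_relabel]
  refine (P.relabel_congr (f := Equiv.refl _) ?_ _).trans (P.relabel_refl μ)
  intro i
  fin_cases i
  · exact h0
  · exact h1

/-! ## Evaluation of trees with arbitrary inputs -/

/-- The operation `x`, whose inputs `b` are marked by `f b`, is the composite of the operations `μ`
along a tree. -/
inductive Evaluates (P : SymmetricOperad k) {G A : Type} (μ : G → P.obj (Fin 2)) :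
    BTree G A → (B : Type) → [Finite B] → (B → A) → P.obj B → Prop
  | leaf (a : A) : Evaluates P μ (.leaf a) Unit (fun _ => a) P.one
  | node (g : G) (s t : BTree G A) (B C : Type) [Finite B] [Finite C] (f : B → A) (f' : C → A)
      (x : P.obj B) (y : P.obj C) : Evaluates P μ s B f x → Evaluates P μ t C f' y →
      Evaluates P μ (.node g s t) (B ⊕ C) (Sum.elim f f') (P.bin (μ g) x y)
  | relabel (t : BTree G A) (B C : Type) [Finite B] [Finite C] (e : B ≃ C) (f : B → A)
      (f' : C → A) (x : P.obj B) (h : ∀ b, f' (e b) = f b) : Evaluates P μ t B f x →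
      Evaluates P μ t C f' (P.relabel e x)

/-- The input set `t.Pos` of `evalPos` depends on the tree, and substitution changes it by
bijections. `Evaluates` is closed under relabelling, so statements about `bind` become inductions
without transport. -/
theorem evaluates_evalPos (P : SymmetricOperad k) {G A : Type} (μ : G → P.obj (Fin 2))
    (t : BTree G A) : Evaluates P μ t t.Pos t.label (P.evalPos μ t) := by
  induction t with
  | leaf a => exact .leaf a
  | node g s t hs ht => exact .node g s t _ _ _ _ _ _ hs ht

theorem evaluates_eval (P : SymmetricOperad k) {G A : Type} [Finite A] (μ : G → P.obj (Fin 2))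
    (t : BTree G A) (ht : t.IsMultilinear) : Evaluates P μ t A id (P.eval μ t) := by
  rw [eval, dif_pos ht]
  exact .relabel t _ _ _ _ _ _ (fun _ => rfl) (P.evaluates_evalPos μ t)

namespace Evaluates

variable {P : SymmetricOperad k} {G A : Type} {μ : G → P.obj (Fin 2)}

/-- Uniqueness up to a bijection that respects the marks. When the marking is the identity, the
bijection is forced to be the labelling of the leaves, so a derivation of `Evaluates` proves an
equation about `eval` (`eq_eval`). -/
theorem exists_equiv {t : BTree G A} {B : Type} [Finite B] {f : B → A} {x : P.obj B}
    (h : Evaluates P μ t B f x) :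
    ∃ e : t.Pos ≃ B, (∀ p, f (e p) = t.label p) ∧ x = P.relabel e (P.evalPos μ t) := by
  induction h with
  | leaf a => exact ⟨Equiv.refl _, fun _ => rfl, (P.relabel_refl _).symm⟩
  | node g s t B C f f' x y _ _ hs ht =>
    obtain ⟨e, he, rfl⟩ := hs
    obtain ⟨e', he', rfl⟩ := ht
    refine ⟨Equiv.sumCongr e e', ?_, P.bin_relabel _ _ _ _ _⟩
    rintro (p | p)
    · exact he p
    · exact he' p
  | relabel t B C e f f' x h _ ih =>
    obtain ⟨e', he', rfl⟩ := ih
    exact ⟨e'.trans e, fun p => (h _).trans (he' p), P.relabel_relabel _ _ _⟩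

theorem eq_eval [Finite A] {t : BTree G A} {x : P.obj A} (h : Evaluates P μ t A id x) :
    x = P.eval μ t := by
  obtain ⟨e, he, rfl⟩ := h.exists_equiv
  have hb : t.IsMultilinear := by
    have : t.label = e := funext fun p => (he p).symm
    rw [BTree.IsMultilinear, this]
    exact e.bijective
  rw [eval, dif_pos hb]
  exact P.relabel_congr he _

theorem bind_leaf {t : BTree G A} {B : Type} [Finite B] {f : B → A} {x : P.obj B}
    (h : Evaluates P μ t B f x) {L : Type} (φ : A → BTree G L) (ψ : B → L)
    (hφ : ∀ b, φ (f b) = .leaf (ψ b)) : Evaluates P μ (t.bind φ) B ψ x := by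
  induction h with
  | leaf a =>
    rw [BTree.bind, hφ ()]
    exact .leaf _
  | node g s t B C f f' x y _ _ hs ht =>
    have h := Evaluates.node (μ := μ) g _ _ _ _ _ _ _ _ (hs (ψ ∘ Sum.inl) (fun b => hφ (.inl b)))
      (ht (ψ ∘ Sum.inr) (fun b => hφ (.inr b)))
    rwa [Sum.elim_comp_inl_inr] at h
  | relabel t B C e f f' x h _ ih =>
    exact .relabel _ _ _ _ (ψ ∘ e) _ _ (fun _ => rfl) (ih _ fun b => by rw [← h, hφ]; rfl)

/-- By `he`, exactly one input is marked `none`, namely `e.symm none`; the other marks may repeat.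
The induction follows the path from the root to that input. -/
theorem graft {t : BTree G (Option A)} {B : Type} [Finite B] {f : B → Option A} {x : P.obj B}
    (h : Evaluates P μ t B f x) {L : Type} (φ : Option A → BTree G L) (ψ : A → L)
    (hφ : ∀ a, φ (some a) = .leaf (ψ a)) {C : Type} [Finite C] {f' : C → L} {y : P.obj C}
    (hy : Evaluates P μ (φ none) C f' y) {B' : Type} [Finite B'] (e : B ≃ Option B') (h' : B' → A)
    (he : ∀ b, f b = Option.map h' (e b)) :
    Evaluates P μ (t.bind φ) (B' ⊕ C) (Sum.elim (ψ ∘ h') f') (P.comp (P.relabel e x) y) := by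
  classical
  induction h generalizing B' with
  | leaf a =>
    -- The only input of a leaf must be the grafting point, so `B'` is empty and the unit law
    -- `one_comp` applies.
    have h0 : e () = none := by
      obtain ⟨⟨⟩, h⟩ := e.surjective none
      exact h
    have hB : IsEmpty B' := ⟨fun b => by
      obtain ⟨⟨⟩, h⟩ := e.surjective (some b)
      rw [h0] at h; cases h⟩
    obtain rfl : a = none := (he ()).trans (by rw [h0]; rfl)
    have h1 : P.relabel e P.one
        = P.relabel (Equiv.optionCongr (Equiv.equivOfIsEmpty Empty B'))
          (P.relabel unitOptionEquiv P.one) := by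
      rw [relabel_relabel]
      exact P.relabel_congr (fun _ => h0) _
    rw [h1, comp_relabel_left, one_comp, relabel_relabel]
    exact .relabel _ _ _ _ _ _ _ (fun b => rfl) hy
  | relabel t B D e' f f' x h _ ih =>
    rw [relabel_relabel]
    exact ih _ h' fun b => by rw [← h, he]; rfl
  | node g s t B₁ B₂ f f' x y' hs ht hs' ht' =>
    rcases hb : e.symm none with b | b
    · let e₁ : B₁ ≃ Option {c // c ≠ b} := (Equiv.optionSubtypeNe b).symm
      let E : B₁ ⊕ B₂ ≃ Option ({c // c ≠ b} ⊕ B₂) :=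
        (Equiv.sumCongr e₁ (Equiv.refl _)).trans (optionSumEquiv _ _)
      have hE : E (.inl b) = none := by simp [E, e₁, optionSumEquiv]
      have hn : (E.symm.trans e) none = none := by
        rw [Equiv.trans_apply, ← hE, Equiv.symm_apply_apply, ← hb, Equiv.apply_symm_apply]
      -- The grafting point `b` lies in the left branch, and `E` singles it out there. Both `E` and
      -- `e` send it to `none`, so they differ by a bijection of the remaining inputs.
      obtain ⟨e₂, he₂⟩ : ∃ e₂, Equiv.optionCongr e₂ = E.symm.trans e := by
        refine ⟨Equiv.removeNone (E.symm.trans e), ?_⟩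
        ext1 (_ | a)
        · exact hn.symm
        · rw [Equiv.optionCongr_apply, Option.map_some]
          refine Equiv.removeNone_some _ (Option.ne_none_iff_exists'.1 fun h => ?_)
          exact Option.some_ne_none a ((E.symm.trans e).injective (h.trans hn.symm))
      have hee : ∀ c, e c = Option.map e₂ (E c) := fun c => by
        rw [← Equiv.optionCongr_apply, he₂]; simp
      have key := (hs' e₁ (h' ∘ e₂ ∘ Sum.inl) (fun c => by
        have := he (.inl c)
        rw [Sum.elim_inl, hee] at this
        rw [this]
        change Option.map h' (Option.map e₂ (optionSumEquiv _ _ (Sum.inl (e₁ c)))) = _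
        rcases e₁ c with _ | _ <;> rfl))
      -- The other branch does not contain the grafting point, so `φ` merely renames its leaves.
      have key₂ := ht.bind_leaf φ (ψ ∘ h' ∘ e₂ ∘ Sum.inr) (fun c => by
        have := he (.inr c)
        rw [Sum.elim_inr, hee] at this
        rw [this]
        exact hφ _)
      have hr : P.comp (P.relabel e (P.bin (μ g) x y')) y
          = P.relabel ((sumRightCommEquiv _ _ _).trans (Equiv.sumCongr e₂ (Equiv.refl _)))
            (P.bin (μ g) (P.comp (P.relabel e₁ x) y) y') := by
        rw [← relabel_relabel, ← comp_bin_left, ← comp_relabel_left, relabel_relabel]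
        have := P.bin_relabel (μ g) e₁ (Equiv.refl _) x y'
        rw [P.relabel_refl] at this
        rw [this, relabel_relabel]
        congr 2
        refine P.relabel_congr (fun c => ?_) _
        rw [hee]; rfl
      rw [hr]
      refine .relabel _ _ _ _ _ _ _ ?_ (.node g _ _ _ _ _ _ _ _ key key₂)
      rintro ((c | c) | c) <;> rfl
    · let e₁ : B₂ ≃ Option {c // c ≠ b} := (Equiv.optionSubtypeNe b).symm
      let E : B₁ ⊕ B₂ ≃ Option (B₁ ⊕ {c // c ≠ b}) :=
        (Equiv.sumCongr (Equiv.refl _) e₁).trans (sumOptionEquiv _ _)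
      have hE : E (.inr b) = none := by simp [E, e₁, sumOptionEquiv]
      have hn : (E.symm.trans e) none = none := by
        rw [Equiv.trans_apply, ← hE, Equiv.symm_apply_apply, ← hb, Equiv.apply_symm_apply]
      obtain ⟨e₂, he₂⟩ : ∃ e₂, Equiv.optionCongr e₂ = E.symm.trans e := by
        refine ⟨Equiv.removeNone (E.symm.trans e), ?_⟩
        ext1 (_ | a)
        · exact hn.symm
        · rw [Equiv.optionCongr_apply, Option.map_some]
          refine Equiv.removeNone_some _ (Option.ne_none_iff_exists'.1 fun h => ?_)
          exact Option.some_ne_none a ((E.symm.trans e).injective (h.trans hn.symm))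
      have hee : ∀ c, e c = Option.map e₂ (E c) := fun c => by
        rw [← Equiv.optionCongr_apply, he₂]; simp
      have key := (ht' e₁ (h' ∘ e₂ ∘ Sum.inr) (fun c => by
        have := he (.inr c)
        rw [Sum.elim_inr, hee] at this
        rw [this]
        change Option.map h' (Option.map e₂ (sumOptionEquiv _ _ (Sum.inr (e₁ c)))) = _
        rcases e₁ c with _ | _ <;> rfl))
      have key₂ := hs.bind_leaf φ (ψ ∘ h' ∘ e₂ ∘ Sum.inl) (fun c => by
        have := he (.inl c)
        rw [Sum.elim_inl, hee] at this
        rw [this]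
        exact hφ _)
      have hr : P.comp (P.relabel e (P.bin (μ g) x y')) y
          = P.relabel ((Equiv.sumAssoc _ _ _).symm.trans (Equiv.sumCongr e₂ (Equiv.refl _)))
            (P.bin (μ g) x (P.comp (P.relabel e₁ y') y)) := by
        rw [← relabel_relabel, ← comp_bin_right, ← comp_relabel_left, relabel_relabel]
        have := P.bin_relabel (μ g) (Equiv.refl _) e₁ x y'
        rw [P.relabel_refl] at this
        rw [this, relabel_relabel]
        congr 2
        refine P.relabel_congr (fun c => ?_) _
        rw [hee]; rfl
      rw [hr]
      refine .relabel _ _ _ _ _ _ _ ?_ (.node g _ _ _ _ _ _ _ _ key₂ key)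
      rintro (c | (c | c)) <;> rfl

end Evaluates

/-! ## The universal property of free operads and of quotients -/

theorem eval_relabel (P : SymmetricOperad k) {G A B : Type} [Finite A] [Finite B]
    (μ : G → P.obj (Fin 2)) (e : A ≃ B) (t : TreeMonomial G A) :
    P.eval μ (TreeMonomial.relabel e t).1 = P.relabel e (P.eval μ t.1) := by
  symm
  refine Evaluates.eq_eval (.relabel _ _ _ _ (fun a => e a) _ _ (fun _ => rfl) ?_)
  exact (P.evaluates_eval μ t.1 t.2).bind_leaf _ _ (fun _ => rfl)

theorem eval_graft (P : SymmetricOperad k) {G A B : Type} [Finite A] [Finite B]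
    (μ : G → P.obj (Fin 2)) (s : TreeMonomial G (Option A)) (t : TreeMonomial G B) :
    P.eval μ (TreeMonomial.graft s t).1 = P.comp (P.eval μ s.1) (P.eval μ t.1) := by
  symm
  apply Evaluates.eq_eval
  have h := (P.evaluates_eval μ s.1 s.2).graft (TreeMonomial.graftMap t.1) Sum.inl (fun _ => rfl)
    (f' := Sum.inr) ((P.evaluates_eval μ t.1 t.2).bind_leaf _ _ (fun _ => rfl)) (Equiv.refl _) id
    (fun b => by simp)
  rw [P.relabel_refl] at h
  have hid : (id : A ⊕ B → A ⊕ B) = Sum.elim (Sum.inl ∘ id) Sum.inr := by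
    funext a; rcases a with a | a <;> rfl
  rw [hid]
  exact h

variable (k) in
/-- A tree monomial, as an element of the free operad. -/
noncomputable def freeTree {G A : Type} [Finite A] (t : TreeMonomial G A) : (free k G).obj A :=
  (Finsupp.single t 1 : TreeMonomial G A →₀ k)

/-- The linear map on a component of the free operad with given values on tree monomials. -/
noncomputable def freeDesc {G A : Type} [Finite A] {M : Type*} [AddCommGroup M] [Module k M]
    (f : TreeMonomial G A → M) : (free k G).obj A →ₗ[k] M :=
  Finsupp.linearCombination k f

theorem freeDesc_freeTree {G A : Type} [Finite A] {M : Type*} [AddCommGroup M] [Module k M]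
    (f : TreeMonomial G A → M) (t : TreeMonomial G A) : freeDesc f (freeTree k t) = f t :=
  (Finsupp.linearCombination_single _ _ _).trans (one_smul _ _)

theorem free_induction {G A : Type} [Finite A] {p : (free k G).obj A → Prop}
    (x : (free k G).obj A) (zero : p 0) (add : ∀ y z, p y → p z → p (y + z))
    (smul : ∀ (c : k) y, p y → p (c • y)) (tree : ∀ t, p (freeTree k t)) : p x := by
  refine Finsupp.induction_linear (motive := p) x zero (fun y z => add y z) fun t a => ?_
  have h := smul a _ (tree t)
  have e : (Finsupp.single t a : TreeMonomial G A →₀ k) = a • Finsupp.single t 1 := by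
    rw [Finsupp.smul_single, smul_eq_mul, mul_one]
  rw [e]
  exact h

theorem relabel_freeTree {G A B : Type} [Finite A] [Finite B] (e : A ≃ B)
    (t : TreeMonomial G A) :
    (free k G).relabel e (freeTree k t) = freeTree k (TreeMonomial.relabel e t) :=
  Finsupp.mapDomain_single

theorem comp_freeTree {G A B : Type} [Finite A] [Finite B] (s : TreeMonomial G (Option A))
    (t : TreeMonomial G B) :
    (free k G).comp (freeTree k s) (freeTree k t) = freeTree k (TreeMonomial.graft s t) := by
  change Finsupp.linearCombination k (fun x : TreeMonomial G (Option A) =>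
      Finsupp.lmapDomain k k (TreeMonomial.graft (B := B) x)) (Finsupp.single s 1)
    (Finsupp.single t 1) = Finsupp.single (TreeMonomial.graft s t) 1
  rw [Finsupp.linearCombination_single, one_smul, Finsupp.lmapDomain_apply,
    Finsupp.mapDomain_single]

/-- The morphism out of a free operad that sends the generators to `μ`. -/
noncomputable def freeLift (P : SymmetricOperad k) {G : Type} (μ : G → P.obj (Fin 2)) :
    Hom (free k G) P where
  app A _ := freeDesc (fun t : TreeMonomial G A => P.eval μ t.1)
  map_relabel e x := by
    induction x using free_induction with
    | zero => simp only [map_zero]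
    | add x y hx hy => simp only [map_add, hx, hy]
    | smul c x hx => simp only [map_smul, hx]
    | tree t => rw [relabel_freeTree, freeDesc_freeTree, freeDesc_freeTree, eval_relabel]
  map_one := (freeDesc_freeTree _ TreeMonomial.one).trans (Evaluates.eq_eval (.leaf ())).symm
  map_comp x y := by
    induction x using free_induction with
    | zero => simp only [map_zero, LinearMap.zero_apply]
    | add x x' hx hx' => simp only [map_add, LinearMap.add_apply, hx, hx']
    | smul c x hx => simp only [map_smul, LinearMap.smul_apply, hx]
    | tree s =>
    induction y using free_induction with
    | zero => simp only [map_zero]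
    | add y y' hy hy' => simp only [map_add, hy, hy']
    | smul c y hy => simp only [map_smul, hy]
    | tree t =>
      rw [comp_freeTree, freeDesc_freeTree, freeDesc_freeTree, freeDesc_freeTree, eval_graft]

theorem freeLift_freeGen (P : SymmetricOperad k) {G : Type} (μ : G → P.obj (Fin 2)) (g : G) :
    (P.freeLift μ).app (Fin 2) (freeGen k g) = μ g := by
  refine (freeDesc_freeTree _ (TreeMonomial.corolla g)).trans ?_
  rw [eval, dif_pos (TreeMonomial.corolla g).2]
  exact P.bin_one_one _ _ rfl rfl

theorem Hom.map_bin {P Q : SymmetricOperad k} (φ : Hom P Q) (μ : P.obj (Fin 2)) {A B : Type}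
    [Finite A] [Finite B] (x : P.obj A) (y : P.obj B) :
    φ.app _ (P.bin μ x y) = Q.bin (φ.app _ μ) (φ.app _ x) (φ.app _ y) := by
  simp only [bin, map_comp, map_relabel]

theorem Hom.map_evalPos {P Q : SymmetricOperad k} (φ : Hom P Q) {G A : Type}
    (μ : G → P.obj (Fin 2)) (t : BTree G A) :
    φ.app _ (P.evalPos μ t) = Q.evalPos (fun g => φ.app _ (μ g)) t := by
  induction t with
  | leaf a => exact φ.map_one
  | node g s t hs ht => exact (φ.map_bin _ _ _).trans (by rw [hs, ht]; rfl)

theorem Hom.map_eval {P Q : SymmetricOperad k} (φ : Hom P Q) {G A : Type} [Finite A]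
    (μ : G → P.obj (Fin 2)) (t : BTree G A) :
    φ.app _ (P.eval μ t) = Q.eval (fun g => φ.app _ (μ g)) t := by
  unfold eval
  split_ifs
  · rw [φ.map_relabel, φ.map_evalPos]
  · exact map_zero _

/-- The projection to the quotient by an ideal. -/
def quotientHom (P : SymmetricOperad k) (I : OperadIdeal P) : Hom P (P.quotient I) where
  app A _ := (I.carrier A).mkQ
  map_relabel _ _ := rfl
  map_one := rfl
  map_comp _ _ := rfl

theorem Hom.app_eq_zero_of_inIdeal {P Q : SymmetricOperad k} (φ : Hom P Q)
    {R : (n : ℕ) → P.obj (Fin n) → Prop} (hR : ∀ n x, R n x → φ.app (Fin n) x = 0) {A : Type}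
    [Finite A] {x : P.obj A} (hx : P.InIdeal R A x) : φ.app A x = 0 := by
  induction hx with
  | mem n x hx => exact hR n x hx
  | zero A => exact map_zero _
  | add A x y _ _ hx hy => rw [map_add, hx, hy, add_zero]
  | smul A c x _ hx => rw [map_smul, hx, smul_zero]
  | relabel A B e x _ hx => rw [φ.map_relabel, hx, map_zero]
  | comp_left A B x y _ hx => rw [φ.map_comp, hx, map_zero, LinearMap.zero_apply]
  | comp_right A B x y _ hy => rw [φ.map_comp, hy, map_zero]

/-- The morphism induced on the quotient by the ideal generated by `R`. -/
def Hom.quotientLift {P Q : SymmetricOperad k} (φ : Hom P Q)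
    (R : (n : ℕ) → P.obj (Fin n) → Prop) (hR : ∀ n x, R n x → φ.app (Fin n) x = 0) :
    Hom (P.quotient (P.idealSpan R)) Q where
  app A _ := Submodule.liftQ ((P.idealSpan R).carrier A) (φ.app A)
    (fun _ hx => φ.app_eq_zero_of_inIdeal hR hx)
  map_relabel e x := by
    obtain ⟨x, rfl⟩ := Submodule.Quotient.mk_surjective _ x
    exact φ.map_relabel e x
  map_one := φ.map_one
  map_comp x y := by
    obtain ⟨x, rfl⟩ := Submodule.Quotient.mk_surjective _ x
    obtain ⟨y, rfl⟩ := Submodule.Quotient.mk_surjective _ y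
    exact φ.map_comp x y

end SymmetricOperad

/-! ### Arbitrary trees from multilinear ones -/

namespace TreeMonomial

variable {G A B : Type}

/-- The tree with root vertex `g` and branches `s` and `t`. -/
def node (g : G) (s : TreeMonomial G A) (t : TreeMonomial G B) : TreeMonomial G (A ⊕ B) :=
  graft (relabel ((Equiv.sumComm Unit A).trans (Equiv.optionEquivSumPUnit A).symm)
    (graft (relabel SymmetricOperad.finTwoOptionEquiv (corolla g)) s)) t

theorem node_val (g : G) (s : TreeMonomial G A) (t : TreeMonomial G B) :
    (node g s t).1
      = .node g (s.1.bind fun a => .leaf (.inl a)) (t.1.bind fun b => .leaf (.inr b)) := by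
  change BTree.node g (((s.1.bind _).bind _).bind _) _ = _
  rw [BTree.bind_bind, BTree.bind_bind]
  rfl

end TreeMonomial

/-- Leaves that carry the same label are first kept apart, and `f` records the identification
afterwards. This is how trees with repeated leaves are reached from an operad. -/
theorem BTree.exists_treeMonomial {G A : Type} (s : BTree G A) :
    ∃ (B : Type) (_ : Finite B) (t : TreeMonomial G B) (f : B → A),
      s = t.1.bind fun b => .leaf (f b) := by
  induction s with
  | leaf a => exact ⟨Unit, inferInstance, TreeMonomial.one, fun _ => a, rfl⟩
  | node g s t hs ht =>
    obtain ⟨B, hB, s, f, rfl⟩ := hs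
    obtain ⟨C, hC, t, f', rfl⟩ := ht
    refine ⟨B ⊕ C, inferInstance, TreeMonomial.node g s t, Sum.elim f f', ?_⟩
    rw [TreeMonomial.node_val, BTree.bind, BTree.bind_bind, BTree.bind_bind]
    rfl

namespace SymmetricOperad

variable {k : Type u} [Field k]

/-! ## Linear combinations of trees with arbitrary leaves -/

theorem bin_freeTree {G A B : Type} [Finite A] [Finite B] (g : G) (s : TreeMonomial G A)
    (t : TreeMonomial G B) :
    (free k G).bin (freeGen k g) (freeTree k s) (freeTree k t)
      = freeTree k (TreeMonomial.node g s t) := by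
  change (free k G).bin (freeTree k (TreeMonomial.corolla g)) _ _ = _
  rw [bin, relabel_freeTree, comp_freeTree, relabel_freeTree, comp_freeTree]
  rfl

/-- The product of linear combinations of trees that joins two trees by a root vertex `g`. -/
noncomputable def treeMul {G A : Type} (g : G) :
    (BTree G A →₀ k) →ₗ[k] (BTree G A →₀ k) →ₗ[k] (BTree G A →₀ k) :=
  Finsupp.linearCombination k (fun s => Finsupp.lmapDomain k k (BTree.node g s))

theorem treeMul_single {G A : Type} (g : G) (s t : BTree G A) :
    treeMul (k := k) g (Finsupp.single s 1) (Finsupp.single t 1)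
      = Finsupp.single (.node g s t) 1 := by
  rw [treeMul, Finsupp.linearCombination_single, one_smul, Finsupp.lmapDomain_apply,
    Finsupp.mapDomain_single]

/-- Substitution of the trees `φ b` for the inputs `b` of an element of the free operad. -/
noncomputable def plug {G A B : Type} [Finite B] (φ : B → BTree G A) :
    (free k G).obj B →ₗ[k] (BTree G A →₀ k) :=
  freeDesc (fun t => Finsupp.single (t.1.bind φ) 1)

theorem plug_freeTree {G A B : Type} [Finite B] (φ : B → BTree G A) (t : TreeMonomial G B) :
    plug φ (freeTree k t) = Finsupp.single (t.1.bind φ) 1 :=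
  freeDesc_freeTree _ _

theorem plug_relabel {G A B C : Type} [Finite B] [Finite C] (φ : C → BTree G A) (e : B ≃ C)
    (x : (free k G).obj B) : plug φ ((free k G).relabel e x) = plug (fun b => φ (e b)) x := by
  induction x using free_induction with
  | zero => simp only [map_zero]
  | add x y hx hy => simp only [map_add, hx, hy]
  | smul c x hx => simp only [map_smul, hx]
  | tree t =>
    rw [relabel_freeTree, plug_freeTree, plug_freeTree, TreeMonomial.relabel, BTree.bind_bind]
    rfl

theorem plug_comp_freeTree {G A B C : Type} [Finite B] [Finite C] (φ : B ⊕ C → BTree G A)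
    (x : (free k G).obj (Option B)) (t : TreeMonomial G C) :
    plug φ ((free k G).comp x (freeTree k t))
      = plug (fun o => o.elim (t.1.bind fun c => φ (.inr c)) (fun b => φ (.inl b))) x := by
  induction x using free_induction with
  | zero => simp only [map_zero, LinearMap.zero_apply]
  | add x y hx hy => simp only [map_add, LinearMap.add_apply, hx, hy]
  | smul c x hx => simp only [map_smul, LinearMap.smul_apply, hx]
  | tree s =>
    rw [comp_freeTree, plug_freeTree, plug_freeTree, TreeMonomial.graft, BTree.bind_bind]
    congr 2
    funext o
    rcases o with _ | b
    · rw [TreeMonomial.graftMap, BTree.bind_bind]; rfl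
    · rfl

/-- Operadic composites become products in the free nonassociative algebra, where identities between
elements can be used. -/
theorem plug_bin {G A B C : Type} [Finite B] [Finite C] (φ : B ⊕ C → BTree G A) (g : G)
    (x : (free k G).obj B) (y : (free k G).obj C) :
    plug φ ((free k G).bin (freeGen k g) x y)
      = treeMul g (plug (fun b => φ (.inl b)) x) (plug (fun c => φ (.inr c)) y) := by
  induction x using free_induction with
  | zero => simp only [bin, map_zero, LinearMap.zero_apply]
  | add x y hx hy =>
    simp only [bin] at hx hy
    simp only [bin, map_add, LinearMap.add_apply, hx, hy]
  | smul c x hx =>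
    simp only [bin] at hx
    simp only [bin, map_smul, LinearMap.smul_apply, hx]
  | tree s =>
  induction y using free_induction with
  | zero => simp only [bin, map_zero]
  | add x y hx hy =>
    simp only [bin] at hx hy
    simp only [bin, map_add, hx, hy]
  | smul c x hx =>
    simp only [bin] at hx
    simp only [bin, map_smul, hx]
  | tree t =>
    rw [bin_freeTree, plug_freeTree, plug_freeTree, plug_freeTree, treeMul_single,
      TreeMonomial.node_val, BTree.bind, BTree.bind_bind, BTree.bind_bind]
    rfl

theorem plug_bin_opp {G A B C : Type} [Finite B] [Finite C] (φ : B ⊕ C → BTree G A) (g : G)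
    (x : (free k G).obj B) (y : (free k G).obj C) :
    plug φ ((free k G).bin ((free k G).opp (freeGen k g)) x y)
      = treeMul g (plug (fun c => φ (.inr c)) y) (plug (fun b => φ (.inl b)) x) := by
  induction x using free_induction with
  | zero => simp only [bin, map_zero, LinearMap.zero_apply]
  | add x y hx hy =>
    simp only [bin] at hx hy
    simp only [bin, map_add, LinearMap.add_apply, hx, hy]
  | smul c x hx =>
    simp only [bin] at hx
    simp only [bin, map_smul, LinearMap.smul_apply, hx]
  | tree s =>
  induction y using free_induction with
  | zero => simp only [bin, map_zero, LinearMap.zero_apply]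
  | add x y hx hy =>
    simp only [bin] at hx hy
    simp only [bin, map_add, LinearMap.add_apply, hx, hy]
  | smul c x hx =>
    simp only [bin] at hx
    simp only [bin, map_smul, LinearMap.smul_apply, hx]
  | tree t =>
    rw [opp, freeGen, plug_freeTree, plug_freeTree, treeMul_single]
    change plug φ ((free k G).bin ((free k G).relabel _ (freeTree k (TreeMonomial.corolla g))) _ _)
      = _
    rw [bin, relabel_freeTree, relabel_freeTree, comp_freeTree, relabel_freeTree, comp_freeTree,
      plug_freeTree]
    congr 1
    change BTree.node g ((t.1.bind _).bind _) ((((s.1.bind _).bind _).bind _).bind _) = _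
    simp only [BTree.bind_bind]
    rfl

theorem Evaluates.plug_eq {G A B L : Type} [Finite B] {t : BTree G A} {f : B → A}
    {x : (free k G).obj B} (h : Evaluates (free k G) (freeGen k) t B f x) (φ : A → BTree G L) :
    plug (fun b => φ (f b)) x = Finsupp.single (t.bind φ) 1 := by
  induction h with
  | leaf a => exact plug_freeTree _ TreeMonomial.one
  | node g s t B C f f' x y _ _ hs ht =>
    rw [plug_bin, BTree.bind, ← treeMul_single, ← hs, ← ht]
    rfl
  | relabel t B C e f f' x h _ ih =>
    rw [plug_relabel, ← ih]
    simp only [h]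

theorem plug_eval {G A L : Type} [Finite A] (φ : A → BTree G L) {t : BTree G A}
    (ht : t.IsMultilinear) :
    plug φ ((free k G).eval (freeGen k) t) = Finsupp.single (t.bind φ) 1 :=
  ((free k G).evaluates_eval _ t ht).plug_eq φ

/-- Substitution of trees in an element of an ideal of the free operad gives an element that comes
from the ideal by an identification of inputs. -/
theorem OperadIdeal.exists_plug_eq {G L : Type} (J : OperadIdeal (free k G)) (A : Type) [Finite A] :
    ∀ (C : Type) [Finite C] (r : (free k G).obj (A ⊕ C)) (_ : r ∈ J.carrier (A ⊕ C))
      (φ : A ⊕ C → BTree G L) (f : C → L) (_ : ∀ c, φ (.inr c) = .leaf (f c)),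
      ∃ (B : Type) (_ : Finite B) (f' : B → L) (x : (free k G).obj B), x ∈ J.carrier B ∧
        plug (fun b => .leaf (f' b)) x = plug φ r := by
  -- Inputs in `A` still await a tree, while those in `C` carry a single leaf. The induction grafts
  -- one tree at a time, and the ideal is closed under this composition.
  refine Finite.induction_empty_option (P := fun A : Type => ∀ _ : Finite A,
    ∀ (C : Type) [Finite C] (r : (free k G).obj (A ⊕ C)) (_ : r ∈ J.carrier (A ⊕ C))
      (φ : A ⊕ C → BTree G L) (f : C → L) (_ : ∀ c, φ (.inr c) = .leaf (f c)),
      ∃ (B : Type) (_ : Finite B) (f' : B → L) (x : (free k G).obj B), x ∈ J.carrier B ∧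
        plug (fun b => .leaf (f' b)) x = plug φ r) ?_ ?_ ?_ A inferInstance
  · intro A A' e ih _ C _ r hr φ f hφ
    have : Finite A := Finite.of_equiv _ e.symm
    obtain ⟨B, hB, f', x, hx, h⟩ := ih this C _
      (J.relabel_mem (Equiv.sumCongr e.symm (Equiv.refl C)) r hr)
      (fun a => φ (Equiv.sumCongr e (Equiv.refl C) a)) f hφ
    refine ⟨B, hB, f', x, hx, h.trans ?_⟩
    rw [plug_relabel]
    congr 1
    congr 1
    funext a
    rcases a with a | a
    · exact congrArg (fun a => φ (.inl a)) (e.apply_symm_apply a)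
    · rfl
  · intro _ C _ r hr φ f hφ
    refine ⟨PEmpty ⊕ C, inferInstance, Sum.elim PEmpty.elim f, r, hr, ?_⟩
    congr 2
    funext a
    rcases a with a | a
    · exact a.elim
    · exact (hφ a).symm
  · intro A _ ih _ C _ r hr φ f hφ
    -- Once the tree at `none` is grafted in multilinear form, its inputs `D` join `C` among the
    -- inputs that carry leaves.
    obtain ⟨D, hD, t, f', ht⟩ := (φ (.inl none)).exists_treeMonomial
    obtain ⟨B, hB, f'', x, hx, h⟩ := ih inferInstance (C ⊕ D) _
      (J.relabel_mem (Equiv.sumAssoc A C D) _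
        (J.comp_mem_left _ (freeTree k t) (J.relabel_mem (optionSumEquiv A C) r hr)))
      (Sum.elim (fun a => φ (.inl (some a))) (Sum.elim (fun c => φ (.inr c))
        (fun d => .leaf (f' d)))) (Sum.elim f f')
      (by rintro (c | d); exacts [hφ c, rfl])
    refine ⟨B, hB, f'', x, hx, h.trans ?_⟩
    rw [plug_relabel, plug_comp_freeTree, plug_relabel]
    congr 2
    funext a
    rcases a with (_ | a) | c
    · exact ht.symm
    · rfl
    · rfl

open Classical in
/-- The multilinear part of a linear combination of trees. -/
noncomputable def multilinearPart {G A : Type} [Finite A] :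
    (BTree G A →₀ k) →ₗ[k] (free k G).obj A :=
  Finsupp.linearCombination k
    (fun t => if h : t.IsMultilinear then freeTree k ⟨t, h⟩ else 0)

/-- Up to a bijection of leaf positions, the new labelling is `f` after the bijective labelling of
`t`. Hence the multilinear part keeps an identification of inputs exactly when it is a relabelling.
-/
theorem _root_.BTree.isMultilinear_bind_leaf {G A B : Type} (t : TreeMonomial G B) (f : B → A) :
    (t.1.bind fun b => (.leaf (f b) : BTree G A)).IsMultilinear ↔ Function.Bijective f := by
  let φ : B → BTree G A := fun b => .leaf (f b)
  let e : t.1.Pos ≃ (t.1.bind φ).Pos :=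
    (Equiv.sigmaUnique t.1.Pos fun _ => Unit).symm.trans (BTree.posBind φ t.1).symm
  have h : (t.1.bind φ).label ∘ e = f ∘ t.1.label := by
    funext p
    exact BTree.label_posBind_symm φ t.1 p ()
  rw [BTree.IsMultilinear, ← Function.Bijective.of_comp_iff _ e.bijective, h,
    Function.Bijective.of_comp_iff _ t.2]

theorem multilinearPart_plug {G A B : Type} [Finite A] [Finite B] {f : B → A}
    (hf : Function.Bijective f) (x : (free k G).obj B) :
    multilinearPart (plug (fun b => .leaf (f b)) x)
      = (free k G).relabel (Equiv.ofBijective f hf) x := by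
  induction x using free_induction with
  | zero => simp only [map_zero]
  | add x y hx hy => simp only [map_add, hx, hy]
  | smul c x hx => simp only [map_smul, hx]
  | tree t =>
    rw [plug_freeTree, multilinearPart, Finsupp.linearCombination_single, one_smul,
      dif_pos ((BTree.isMultilinear_bind_leaf t f).2 hf), relabel_freeTree]
    rfl

theorem multilinearPart_plug_eq_zero {G A B : Type} [Finite A] [Finite B] {f : B → A}
    (hf : ¬ Function.Bijective f) (x : (free k G).obj B) :
    multilinearPart (plug (fun b => .leaf (f b)) x) = (0 : (free k G).obj A) := by
  induction x using free_induction with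
  | zero => simp only [map_zero]
  | add x y hx hy => simp only [map_add, hx, hy, add_zero]
  | smul c x hx => simp only [map_smul, hx, smul_zero]
  | tree t =>
    rw [plug_freeTree, multilinearPart, Finsupp.linearCombination_single, one_smul,
      dif_neg (mt (BTree.isMultilinear_bind_leaf t f).1 hf)]

end SymmetricOperad

/-! ## Filtered pre-Lie algebras -/

/-- A decreasing filtration of a space with a bilinear product, multiplicative and such that the
commutators raise the degree by one; the product is pre-Lie up to elements of every term. -/
structure IsPreLieFiltration {k V : Type*} [Field k] [AddCommGroup V] [Module k V]
    (m : V →ₗ[k] V →ₗ[k] V) (N : ℕ → Submodule k V) : Prop where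
  mem_zero : ∀ x, x ∈ N 0
  mul_mem : ∀ {i j x y}, x ∈ N i → y ∈ N j → m x y ∈ N (i + j)
  bracket_mem : ∀ {i j x y}, x ∈ N i → y ∈ N j → m x y - m y x ∈ N (i + j + 1)
  preLie_mem : ∀ n x y z, (m (m x y) z - m x (m y z)) - (m (m x z) y - m x (m z y)) ∈ N n

namespace IsPreLieFiltration

variable {k V : Type*} [Field k] [AddCommGroup V] [Module k V] {m : V →ₗ[k] V →ₗ[k] V}
  {N : ℕ → Submodule k V}

/-- The associator equals [x,y]·z + y·[x,z] − [x, y·z] up to the pre-Lie relator of (y, x, z), and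
each of the three terms contains one extra bracket. -/
theorem associator_mem (h : IsPreLieFiltration m N) {i j l n : ℕ} {x y z : V} (hx : x ∈ N i)
    (hy : y ∈ N j) (hz : z ∈ N l) (hn : i + j + l + 1 = n) :
    m (m x y) z - m x (m y z) ∈ N n := by
  subst hn
  have h1 := h.mul_mem (h.bracket_mem hx hy) hz
  have h2 := h.mul_mem hy (h.bracket_mem hx hz)
  have h3 := h.bracket_mem hx (h.mul_mem hy hz)
  rw [show i + j + 1 + l = i + j + l + 1 by omega] at h1
  rw [show j + (i + l + 1) = i + j + l + 1 by omega] at h2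
  rw [show i + (j + l) + 1 = i + j + l + 1 by omega] at h3
  convert add_mem (sub_mem (add_mem h1 h2) h3) (h.preLie_mem (i + j + l + 1) y x z) using 1
  simp only [map_sub, LinearMap.sub_apply]
  abel

/-- The case `i = 0` is associativity of ∘ in degree zero. The case `i = 1` is needed to regroup the
products with a bracket in the Hertling–Manin relation. -/
theorem anticommutator_associator_mem (h : IsPreLieFiltration m N) {n i : ℕ} (x y : V) {z : V}
    (hz : z ∈ N i) (hn : i + 1 = n) :
    (m (m x y + m y x) z + m z (m x y + m y x))
      - (m x (m y z + m z y) + m (m y z + m z y) x) ∈ N n := by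
  subst hn
  have hx := h.mem_zero x
  have hy := h.mem_zero y
  have h1 := h.associator_mem hx hy hz (n := i + 1) (by omega)
  have h2 := h.associator_mem hx hz hy (n := i + 1) (by omega)
  have h3 := h.associator_mem hz hy hx (n := i + 1) (by omega)
  have h4 := h.associator_mem hz hx hy (n := i + 1) (by omega)
  have h5 := h.mul_mem hy (h.bracket_mem hx hz)
  have h6 := h.mul_mem (h.bracket_mem hz hx) hy
  rw [show 0 + (0 + i + 1) = i + 1 by omega] at h5
  rw [show i + 0 + 1 + 0 = i + 1 by omega] at h6
  convert add_mem (add_mem (add_mem h1 (h.preLie_mem (i + 1) y x z)) (sub_mem h5 h3))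
    (add_mem (sub_mem h6 h4) h2) using 1
  simp only [map_sub, map_add, LinearMap.add_apply, LinearMap.sub_apply]
  abel

/-- The Jacobi expression is the sum of the three cyclic pre-Lie relators, so it lies in every term.
-/
theorem jacobi_mem (h : IsPreLieFiltration m N) (n : ℕ) (x y z : V) :
    (m (m x y - m y x) z - m z (m x y - m y x)) + (m (m y z - m z y) x - m x (m y z - m z y))
      + (m (m z x - m x z) y - m y (m z x - m x z)) ∈ N n := by
  convert add_mem (add_mem (h.preLie_mem n x y z) (h.preLie_mem n y z x)) (h.preLie_mem n z x y)
    using 1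
  simp only [map_sub, LinearMap.sub_apply]
  abel

/-- The identity (xy,z,w) − (x,yz,w) + (x,y,zw) = x(y,z,w) + (x,y,z)w holds in any algebra. With the
symmetry of associators in their last two arguments, it reduces the left side to (x,[y,z],w) +
(x,z,[y,w]). An associator with a bracket among its arguments has degree two. -/
theorem associator_mul_mem (h : IsPreLieFiltration m N) (x y z w : V) :
    (m (m (m x y) z) w - m (m x y) (m z w)) - m x (m (m y z) w - m y (m z w))
      - m (m (m x z) w - m x (m z w)) y ∈ N 2 := by
  have hx := h.mem_zero x
  have hy := h.mem_zero y
  have hz := h.mem_zero z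
  have hw := h.mem_zero w
  have h1 := h.associator_mem hx (h.bracket_mem hy hz) hw rfl
  have h2 := h.associator_mem hx hz (h.bracket_mem hy hw) rfl
  have h3 := h.mul_mem (h.preLie_mem 2 x y z) hw
  have h4 := h.mul_mem hx (h.preLie_mem 2 z y w)
  convert add_mem (add_mem (add_mem h1 h2) (sub_mem h3 h4))
    (add_mem (h.preLie_mem 2 (m x z) y w) (h.preLie_mem 2 x (m z w) y)) using 1
  simp only [map_sub, LinearMap.sub_apply]
  abel

/-- The failure of the Leibniz rule for the bracket is the associator. -/
theorem leibniz_mem (h : IsPreLieFiltration m N) (n : ℕ) (x y z : V) :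
    (m x (m y z + m z y) - m (m y z + m z y) x)
      - (m (m x y - m y x) z + m z (m x y - m y x))
      - (m y (m x z - m z x) + m (m x z - m z x) y)
      + (2 : k) • (m (m x y) z - m x (m y z)) ∈ N n := by
  convert add_mem (h.preLie_mem n x y z)
    (add_mem (h.preLie_mem n y x z) (h.preLie_mem n z x y)) using 1
  simp only [map_sub, map_add, LinearMap.add_apply, LinearMap.sub_apply, two_smul]
  abel

/-- The Leibniz defect of the bracket is −2 times the associator, which is a derivation in its first
argument modulo `N 2`. Expanding this for `c x y` gives the relation, up to regrouping the four
products that contain a bracket of two letters. -/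
theorem hertlingManin_mem (h : IsPreLieFiltration m N) (c l : V → V → V)
    (hc : ∀ x y, c x y = m x y + m y x) (hl : ∀ x y, l x y = m x y - m y x) (x y z w : V) :
    l (c x y) (c z w) -
      (c (l (c x y) z) w + c (l (c x y) w) z + c x (l y (c z w)) + c y (l x (c z w))
        - c (c x z) (l y w) - c (c y z) (l x w) - c (c y w) (l x z) - c (c x w) (l y z)) ∈ N 2 := by
  have hx := h.mem_zero x
  have hy := h.mem_zero y
  have hb : ∀ u v, l u v ∈ N 1 := fun u v => by
    rw [hl]; exact h.bracket_mem (h.mem_zero u) (h.mem_zero v)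
  have leib : ∀ u a b, l u (c a b) - c (l u a) b - c a (l u b)
      + (2 : k) • (m (m u a) b - m u (m a b)) ∈ N 2 := fun u a b => by
    simp only [hc, hl]; exact h.leibniz_mem 2 u a b
  have assoc : ∀ a b u, u ∈ N 1 → c (c a b) u - c a (c b u) ∈ N 2 := fun a b u hu => by
    simp only [hc]; exact h.anticommutator_associator_mem a b hu rfl
  have comm : ∀ a b, c a b = c b a := fun a b => by rw [hc, hc, add_comm]
  have cadd : ∀ a u v, c a (u + v) = c a u + c a v := fun a u v => by
    simp only [hc, map_add, LinearMap.add_apply]; abel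
  have csub : ∀ a u v, c a (u - v) = c a u - c a v := fun a u v => by
    simp only [hc, map_sub, LinearMap.sub_apply]; abel
  have csmul : ∀ a (r : k) u, c a (r • u) = r • c a u := fun a r u => by
    simp only [hc, map_smul, LinearMap.smul_apply, smul_add]
  have cmem : ∀ a u, u ∈ N 2 → c a u ∈ N 2 := fun a u hu => by
    have h1 := h.mul_mem (h.mem_zero a) hu
    have h2 := h.mul_mem hu (h.mem_zero a)
    rw [zero_add] at h1
    rw [hc]; exact add_mem h1 h2
  -- `associator_mul_mem` for x·y and for y·x: the one-sided products on the right add up to the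
  -- symmetrised ones.
  have der : (m (m (c x y) z) w - m (c x y) (m z w)) - c x (m (m y z) w - m y (m z w))
      - c y (m (m x z) w - m x (m z w)) ∈ N 2 := by
    convert add_mem (h.associator_mul_mem x y z w) (h.associator_mul_mem y x z w) using 1
    simp only [hc, map_add, LinearMap.add_apply]
    abel
  have e1 := leib (c x y) z w
  have e2 := cmem x _ (leib y z w)
  have e3 := cmem y _ (leib x z w)
  have f1 := assoc x z _ (hb y w)
  have f2 := assoc y z _ (hb x w)
  have f3 := assoc y w _ (hb x z)
  have f4 := assoc x w _ (hb y z)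
  simp only [cadd, csub, csmul] at e2 e3 der
  rw [comm (l y z) w] at e2
  rw [comm (l x z) w] at e3
  -- In `e1 - e2 - e3` the associators appear as twice the expression in `der`, and are cancelled by
  -- it. The terms `f1` to `f4` reassociate what is left.
  convert add_mem (sub_mem (sub_mem (sub_mem e1 e2) e3) ((N 2).smul_mem (2 : k) der))
    (add_mem (add_mem f1 f2) (add_mem f3 f4)) using 1
  rw [comm (l (c x y) w) z]
  simp only [smul_sub, two_smul]
  abel

end IsPreLieFiltration

namespace SymmetricOperad

variable {k : Type u} [Field k]

theorem bin_add_left (P : SymmetricOperad k) (μ ν : P.obj (Fin 2)) {A B : Type} [Finite A]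
    [Finite B] (x : P.obj A) (y : P.obj B) :
    P.bin (μ + ν) x y = P.bin μ x y + P.bin ν x y := by
  simp only [bin, map_add, LinearMap.add_apply]

theorem bin_smul_left (P : SymmetricOperad k) (c : k) (μ : P.obj (Fin 2)) {A B : Type} [Finite A]
    [Finite B] (x : P.obj A) (y : P.obj B) : P.bin (c • μ) x y = c • P.bin μ x y := by
  simp only [bin, map_smul, LinearMap.smul_apply]

theorem OperadFiltration.bin_mem {P : SymmetricOperad k} (F : OperadFiltration P) {l m n : ℕ}
    {μ : P.obj (Fin 2)} (hμ : μ ∈ F.level l (Fin 2)) {A B : Type} [Finite A] [Finite B]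
    {x : P.obj A} {y : P.obj B} (hx : x ∈ F.level m A) (hy : y ∈ F.level n B) :
    P.bin μ x y ∈ F.level (l + m + n) (A ⊕ B) :=
  F.comp_mem _ _ _ _ (F.relabel_mem _ _ _ (F.comp_mem _ _ _ _ (F.relabel_mem _ _ _ hμ) hx)) hy

/-! ## The pre-Lie operad and linear combinations of trees -/

variable (k) in
/-- The projection of the free operad on one binary operation to the pre-Lie operad. -/
noncomputable def preLieProj : Hom (free k Unit) (PreLie k) :=
  (free k Unit).quotientHom _

theorem preLieProj_surjective : (preLieProj k).IsSurjective :=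
  fun _ _ => Submodule.mkQ_surjective _

theorem mem_lieFiltration_zero {A : Type} [Finite A] (x : (PreLie k).obj A) :
    x ∈ (lieFiltration k).level 0 A :=
  Submodule.subset_span ⟨0, le_refl 0, .any A x⟩

theorem symProduct_eq : symProduct k = (preLieProj k).app _
    ((1 : k) • freeGen k () + (1 : k) • (free k Unit).opp (freeGen k ())) := by
  rw [one_smul, one_smul, map_add, opp, Hom.map_relabel]
  rfl

theorem lieBracket_eq : lieBracket k = (preLieProj k).app _
    ((1 : k) • freeGen k () + (-1 : k) • (free k Unit).opp (freeGen k ())) := by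
  rw [one_smul, neg_one_smul, ← sub_eq_add_neg, map_sub, opp, Hom.map_relabel]
  rfl

theorem lieBracket_mem : lieBracket k ∈ (lieFiltration k).level 1 (Fin 2) :=
  Submodule.subset_span ⟨1, le_refl 1, .mem 2 (lieBracket k) .self⟩

theorem plug_bin_linear {G A B C : Type} [Finite B] [Finite C] (φ : B ⊕ C → BTree G A) (g : G)
    (α β : k) (x : (free k G).obj B) (y : (free k G).obj C) :
    plug φ ((free k G).bin (α • freeGen k g + β • (free k G).opp (freeGen k g)) x y)
      = α • treeMul g (plug (fun b => φ (.inl b)) x) (plug (fun c => φ (.inr c)) y)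
        + β • treeMul g (plug (fun c => φ (.inr c)) y) (plug (fun b => φ (.inl b)) x) := by
  rw [bin_add_left, bin_smul_left, bin_smul_left, map_add, map_smul, map_smul, plug_bin,
    plug_bin_opp]

variable (k) in
/-- The filtration of the space of linear combinations of trees induced by the Lie filtration of
the pre-Lie operad. -/
noncomputable def treeFiltration (A : Type) (n : ℕ) : Submodule k (BTree Unit A →₀ k) :=
  Submodule.span k {v | ∃ (B : Type) (_ : Finite B) (f : B → A) (x : (free k Unit).obj B),
    (preLieProj k).app B x ∈ (lieFiltration k).level n B ∧ plug (fun b => .leaf (f b)) x = v}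

theorem treeFiltration_zero {A : Type} (v : BTree Unit A →₀ k) : v ∈ treeFiltration k A 0 := by
  induction v using Finsupp.induction_linear with
  | zero => exact zero_mem _
  | add v w hv hw => exact add_mem hv hw
  | single s a =>
    rw [← mul_one a, ← smul_eq_mul, ← Finsupp.smul_single]
    refine Submodule.smul_mem _ _ (Submodule.subset_span ?_)
    obtain ⟨B, hB, t, f, rfl⟩ := s.exists_treeMonomial
    exact ⟨B, hB, f, freeTree k t, mem_lieFiltration_zero _, plug_freeTree _ _⟩

theorem treeMul_mem_treeFiltration {A : Type} {i j : ℕ} {v w : BTree Unit A →₀ k}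
    (hv : v ∈ treeFiltration k A i) (hw : w ∈ treeFiltration k A j) :
    treeMul () v w ∈ treeFiltration k A (i + j) := by
  have h := Submodule.apply_mem_map₂ (treeMul ()) hv hw
  rw [treeFiltration, treeFiltration, Submodule.map₂_span_span] at h
  refine Submodule.span_mono ?_ h
  rintro _ ⟨_, ⟨B, hB, f, x, hx, rfl⟩, _, ⟨C, hC, f', y, hy, rfl⟩, rfl⟩
  refine ⟨B ⊕ C, inferInstance, Sum.elim f f', (free k Unit).bin (freeGen k ()) x y, ?_,
    plug_bin _ _ _ _⟩
  rw [Hom.map_bin]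
  have := (lieFiltration k).bin_mem (mem_lieFiltration_zero
    ((preLieProj k).app _ (freeGen k ()))) hx hy
  rwa [zero_add] at this

theorem treeMul_bracket_mem_treeFiltration {A : Type} {i j : ℕ} {v w : BTree Unit A →₀ k}
    (hv : v ∈ treeFiltration k A i) (hw : w ∈ treeFiltration k A j) :
    treeMul () v w - treeMul () w v ∈ treeFiltration k A (i + j + 1) := by
  -- The commutator is written as a single bilinear map, so that membership reduces to generators of
  -- the two spans; there it is the operadic bracket, of degree one.
  have h := Submodule.apply_mem_map₂ (treeMul (k := k) (A := A) () +
    (-1 : k) • (treeMul (k := k) (A := A) ()).flip) hv hw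
  simp only [LinearMap.add_apply, LinearMap.smul_apply, LinearMap.flip_apply, neg_one_smul,
    ← sub_eq_add_neg] at h
  rw [treeFiltration, treeFiltration, Submodule.map₂_span_span] at h
  refine Submodule.span_mono ?_ h
  rintro _ ⟨_, ⟨B, hB, f, x, hx, rfl⟩, _, ⟨C, hC, f', y, hy, rfl⟩, rfl⟩
  refine ⟨B ⊕ C, inferInstance, Sum.elim f f', (free k Unit).bin
    ((1 : k) • freeGen k () + (-1 : k) • (free k Unit).opp (freeGen k ())) x y, ?_, ?_⟩
  · rw [Hom.map_bin, ← lieBracket_eq]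
    have := (lieFiltration k).bin_mem lieBracket_mem hx hy
    rwa [show 1 + i + j = i + j + 1 by omega] at this
  · rw [plug_bin_linear, one_smul]
    rfl

theorem plug_preLieRelator {A : Type} (s t u : BTree Unit A) :
    plug ![s, t, u] ((free k Unit).preLieRelator (freeGen k ()))
      = (Finsupp.single (.node () (.node () s t) u) 1 - Finsupp.single (.node () s (.node () t u)) 1)
        - (Finsupp.single (.node () (.node () s u) t) 1
          - Finsupp.single (.node () s (.node () u t)) (1 : k)) := by
  have hE : (fun _ : Unit => freeGen k ()) = freeGen k := rfl
  have hm : ∀ i j l : Fin 3, Function.Bijective ![i, j, l] →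
      (BTree.node () (.node () (.leaf i) (.leaf j)) (.leaf l) : BTree Unit (Fin 3)).IsMultilinear
      ∧ (BTree.node () (.leaf i) (.node () (.leaf j) (.leaf l)) :
        BTree Unit (Fin 3)).IsMultilinear := by
    change ∀ i j l : Fin 3, Function.Bijective ![i, j, l] →
      Function.Bijective (Sum.elim (Sum.elim (fun _ : Unit => i) fun _ : Unit => j)
        fun _ : Unit => l) ∧
      Function.Bijective (Sum.elim (fun _ : Unit => i)
        (Sum.elim (fun _ : Unit => j) fun _ : Unit => l))
    decide
  have h1 := hm 0 1 2 (by decide)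
  have h2 := hm 0 2 1 (by decide)
  simp only [preLieRelator, map_sub, hE]
  rw [plug_eval _ h1.1, plug_eval _ h1.2, plug_eval _ h2.1, plug_eval _ h2.2]
  rfl

/-- Substituting trees in the relator yields an identification of inputs of some element of the
ideal (`exists_plug_eq`). That element is zero in PL, hence lies in every level. -/
theorem treeFiltration_preLie_single {A : Type} (n : ℕ) (s t u : BTree Unit A) :
    (Finsupp.single (.node () (.node () s t) u) 1 - Finsupp.single (.node () s (.node () t u)) 1)
        - (Finsupp.single (.node () (.node () s u) t) 1
          - Finsupp.single (.node () s (.node () u t)) (1 : k)) ∈ treeFiltration k A n := by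
  obtain ⟨B, hB, f, x, hx, h⟩ := ((free k Unit).idealSpan (PreLieRelation k)).exists_plug_eq (Fin 3)
    Empty ((free k Unit).relabel (Equiv.sumEmpty (Fin 3) Empty).symm
      ((free k Unit).preLieRelator (freeGen k ())))
    (OperadIdeal.relabel_mem _ _ _ (.mem 3 _ .preLie)) (Sum.elim ![s, t, u] Empty.elim) Empty.elim
    (fun c => c.elim)
  rw [plug_relabel] at h
  refine Submodule.subset_span ⟨B, hB, f, x, ?_, h.trans (plug_preLieRelator s t u)⟩
  have h0 : (preLieProj k).app B x = 0 := (Submodule.Quotient.mk_eq_zero _).2 hx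
  rw [h0]
  exact zero_mem _

theorem isPreLieFiltration_treeFiltration (A : Type) :
    IsPreLieFiltration (treeMul (k := k) (A := A) ()) (treeFiltration k A) where
  mem_zero := treeFiltration_zero
  mul_mem := treeMul_mem_treeFiltration
  bracket_mem := treeMul_bracket_mem_treeFiltration
  preLie_mem n x y z := by
    induction x using Finsupp.induction_linear with
    | zero => simp only [map_zero, LinearMap.zero_apply, sub_self, zero_mem]
    | add x x' hx hx' =>
      convert add_mem hx hx' using 1
      simp only [map_add, LinearMap.add_apply]
      abel
    | single s a =>
    induction y using Finsupp.induction_linear with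
    | zero => simp only [map_zero, LinearMap.zero_apply, sub_self, zero_mem]
    | add y y' hy hy' =>
      convert add_mem hy hy' using 1
      simp only [map_add, LinearMap.add_apply]
      abel
    | single t b =>
    induction z using Finsupp.induction_linear with
    | zero => simp only [map_zero, LinearMap.zero_apply, sub_self, zero_mem]
    | add z z' hz hz' =>
      convert add_mem hz hz' using 1
      simp only [map_add, LinearMap.add_apply]
      abel
    | single u c =>
      have e : ∀ (t : BTree Unit A) (a : k), Finsupp.single t a = a • Finsupp.single t 1 :=
        fun t a => by rw [Finsupp.smul_single, smul_eq_mul, mul_one]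
      convert Submodule.smul_mem _ (a * b * c) (treeFiltration_preLie_single n s t u) using 1
      rw [e s a, e t b, e u c]
      simp only [map_smul, LinearMap.smul_apply, treeMul_single]
      module

/-- On a generator, the identification of inputs is either bijective, hence a relabelling that
preserves the level, or has multilinear part zero. -/
theorem preLieProj_multilinearPart_mem {A : Type} [Finite A] {n : ℕ} {v : BTree Unit A →₀ k}
    (hv : v ∈ treeFiltration k A n) :
    (preLieProj k).app A (multilinearPart v) ∈ (lieFiltration k).level n A := by
  induction hv using Submodule.span_induction with
  | mem v hv =>
    obtain ⟨B, hB, f, x, hx, rfl⟩ := hv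
    by_cases hf : Function.Bijective f
    · rw [multilinearPart_plug hf, Hom.map_relabel]
      exact (lieFiltration k).relabel_mem _ _ _ hx
    · rw [multilinearPart_plug_eq_zero hf, map_zero]
      exact zero_mem _
  | zero => simp only [map_zero, zero_mem]
  | add v w _ _ hv hw => rw [map_add, map_add]; exact add_mem hv hw
  | smul c v _ hv => rw [map_smul, map_smul]; exact Submodule.smul_mem _ c hv

/-- The value of a tree, when a vertex `g` stands for the operation
`x, y ↦ α g • (x · y) + β g • (y · x)`. -/
noncomputable def treeEval {G A : Type} (α β : G → k) : BTree G A → (BTree Unit A →₀ k)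
  | .leaf a => Finsupp.single (.leaf a) 1
  | .node g s t => α g • treeMul () (treeEval α β s) (treeEval α β t)
      + β g • treeMul () (treeEval α β t) (treeEval α β s)

theorem Evaluates.exists_plug_eq_treeEval {G A B : Type} [Finite B] {α β : G → k} {t : BTree G A}
    {f : B → A} {z : (PreLie k).obj B}
    (h : Evaluates (PreLie k) (fun g => (preLieProj k).app _
      (α g • freeGen k () + β g • (free k Unit).opp (freeGen k ()))) t B f z) :
    ∃ x, (preLieProj k).app B x = z ∧ plug (fun b => .leaf (f b)) x = treeEval α β t := by
  induction h with
  | leaf a => exact ⟨(free k Unit).one, rfl, plug_freeTree _ TreeMonomial.one⟩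
  | node g s t B C f f' x y _ _ hs ht =>
    obtain ⟨x, rfl, hx⟩ := hs
    obtain ⟨y, rfl, hy⟩ := ht
    exact ⟨_, (preLieProj k).map_bin _ x y, (plug_bin_linear _ _ _ _ _ _).trans (by
      rw [treeEval, ← hx, ← hy]; rfl)⟩
  | relabel t B C e f f' x h _ ih =>
    obtain ⟨x, rfl, hx⟩ := ih
    refine ⟨(free k Unit).relabel e x, (preLieProj k).map_relabel e x, ?_⟩
    rw [plug_relabel, ← hx]
    simp only [h]

/-- The passage from operadic relators to the tree algebra. The coefficients (1, 1) give ∘ and (1,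
−1) give the bracket, so one evaluation treats mixed monomials. -/
theorem preLie_eval_eq {G A : Type} [Finite A] (α β : G → k) (t : BTree G A) :
    (PreLie k).eval (fun g => (preLieProj k).app _
      (α g • freeGen k () + β g • (free k Unit).opp (freeGen k ()))) t
      = (preLieProj k).app A (multilinearPart (treeEval α β t)) := by
  obtain ⟨x, hx, h⟩ := (evaluates_evalPos (PreLie k) _ t).exists_plug_eq_treeEval (α := α) (β := β)
  rw [eval, ← h]
  split_ifs with ht
  · rw [multilinearPart_plug ht, Hom.map_relabel, hx]
  · rw [multilinearPart_plug_eq_zero ht, map_zero]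

/-! ### Filtration levels of the relators -/

theorem associativityRelator_mem :
    (PreLie k).associativityRelator (symProduct k) ∈ (lieFiltration k).level 1 (Fin 3) := by
  rw [associativityRelator, symProduct_eq]
  simp only [preLie_eval_eq (fun _ : Unit => (1 : k)) (fun _ => 1), ← map_sub]
  apply preLieProj_multilinearPart_mem
  simp only [treeEval, one_smul]
  exact (isPreLieFiltration_treeFiltration _).anticommutator_associator_mem _ _
    (treeFiltration_zero _) rfl

theorem jacobiRelator_mem (n : ℕ) :
    (PreLie k).jacobiRelator (lieBracket k) ∈ (lieFiltration k).level n (Fin 3) := by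
  rw [jacobiRelator, lieBracket_eq]
  simp only [preLie_eval_eq (fun _ : Unit => (1 : k)) (fun _ => -1), ← map_add]
  apply preLieProj_multilinearPart_mem
  simp only [treeEval, one_smul, neg_one_smul, ← sub_eq_add_neg]
  exact (isPreLieFiltration_treeFiltration _).jacobi_mem _ _ _ _

variable (k) in
/-- The sign of the opposite pre-Lie product in the generators of the F-manifold operad. -/
def FManGen.sign : FManGen → k
  | .prod => 1
  | .bracket => -1

theorem hertlingManinRelator_mem :
    (PreLie k).hertlingManinRelator (symProduct k) (lieBracket k)
      ∈ (lieFiltration k).level 2 (Fin 4) := by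
  have h : (PreLie k).fManSubst (symProduct k) (lieBracket k)
      = fun g => (preLieProj k).app _ ((1 : k) • freeGen k () + FManGen.sign k g • (free k Unit).opp (freeGen k ())) := by
    funext g
    cases g
    · exact symProduct_eq
    · exact lieBracket_eq
  rw [hertlingManinRelator, h]
  simp only [preLie_eval_eq (fun _ => (1 : k)) (FManGen.sign k), ← map_add, ← map_sub]
  apply preLieProj_multilinearPart_mem
  -- The two functions supplied are the two cases of `treeEval`, so the goal agrees by unfolding.
  exact (isPreLieFiltration_treeFiltration (Fin 4)).hertlingManin_mem
    (fun x y => (1 : k) • treeMul () x y + (1 : k) • treeMul () y x)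
    (fun x y => (1 : k) • treeMul () x y + (-1 : k) • treeMul () y x)
    (fun x y => by simp only [one_smul])
    (fun x y => by simp only [one_smul, neg_one_smul, ← sub_eq_add_neg]) _ _ _ _

end SymmetricOperad

/-- The total weight of the vertices of a tree. -/
def BTree.weight {G A : Type} (w : G → ℕ) : BTree G A → ℕ
  | .leaf _ => 0
  | .node g s t => w g + s.weight w + t.weight w

namespace SymmetricOperad

variable {k : Type u} [Field k]

/-! ## Evaluation in the associated graded operad -/

namespace OperadFiltration

variable {P : SymmetricOperad k} (F : OperadFiltration P)

theorem relabel_toGr {A B : Type} [Finite A] [Finite B] (e : A ≃ B) {n : ℕ} {x : P.obj A}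
    (hx : x ∈ F.level n A) :
    F.gr.relabel e (F.toGr n x hx) = F.toGr n (P.relabel e x) (F.relabel_mem n e x hx) :=
  F.grRelabel_cls e n x hx

theorem comp_toGr {A B : Type} [Finite A] [Finite B] {m n : ℕ} {x : P.obj (Option A)}
    {y : P.obj B} (hx : x ∈ F.level m (Option A)) (hy : y ∈ F.level n B) :
    F.gr.comp (F.toGr m x hx) (F.toGr n y hy)
      = F.toGr (m + n) (P.comp x y) (F.comp_mem m n x y hx hy) :=
  F.grComp_cls m n x y hx hy

theorem toGr_eq_zero {A : Type} [Finite A] {n : ℕ} {x : P.obj A} (hx : x ∈ F.level n A)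
    (hx' : x ∈ F.level (n + 1) A) : F.toGr n x hx = 0 :=
  F.cls_eq_zero _ hx'

theorem toGr_congr {A : Type} [Finite A] {m n : ℕ} {x y : P.obj A} (hx : x ∈ F.level m A)
    (hy : y ∈ F.level n A) (hmn : m = n) (hxy : x = y) : F.toGr m x hx = F.toGr n y hy :=
  F.cls_congr x y hx hy hmn hxy

theorem toGr_add {A : Type} [Finite A] {n : ℕ} {x y : P.obj A} (hx : x ∈ F.level n A)
    (hy : y ∈ F.level n A) :
    F.toGr n (x + y) (add_mem hx hy) = F.toGr n x hx + F.toGr n y hy :=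
  map_add (F.cls n A) ⟨x, hx⟩ ⟨y, hy⟩

theorem toGr_sub {A : Type} [Finite A] {n : ℕ} {x y : P.obj A} (hx : x ∈ F.level n A)
    (hy : y ∈ F.level n A) :
    F.toGr n (x - y) (sub_mem hx hy) = F.toGr n x hx - F.toGr n y hy :=
  map_sub (F.cls n A) ⟨x, hx⟩ ⟨y, hy⟩

theorem toGr_smul {A : Type} [Finite A] {n : ℕ} (c : k) {x : P.obj A} (hx : x ∈ F.level n A) :
    F.toGr n (c • x) (Submodule.smul_mem _ c hx) = c • F.toGr n x hx :=
  map_smul (F.cls n A) c ⟨x, hx⟩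

theorem bin_toGr {l m n : ℕ} {μ : P.obj (Fin 2)} (hμ : μ ∈ F.level l (Fin 2)) {A B : Type}
    [Finite A] [Finite B] {x : P.obj A} {y : P.obj B} (hx : x ∈ F.level m A)
    (hy : y ∈ F.level n B) :
    F.gr.bin (F.toGr l μ hμ) (F.toGr m x hx) (F.toGr n y hy)
      = F.toGr (l + m + n) (P.bin μ x y) (F.bin_mem hμ hx hy) := by
  rw [bin, relabel_toGr, comp_toGr, relabel_toGr, comp_toGr]
  rfl

/-- Composition in the graded operad composes representatives and adds degrees, so a monomial has
the degree given by the total weight of its vertices. -/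
theorem evalPos_toGr {G A : Type} (w : G → ℕ) (μ : G → P.obj (Fin 2))
    (hμ : ∀ g, μ g ∈ F.level (w g) (Fin 2)) (t : BTree G A) :
    ∃ h, F.gr.evalPos (fun g => F.toGr (w g) (μ g) (hμ g)) t
      = F.toGr (t.weight w) (P.evalPos μ t) h := by
  induction t with
  | leaf a => exact ⟨F.one_mem, rfl⟩
  | node g s t hs ht =>
    obtain ⟨hs, es⟩ := hs
    obtain ⟨ht, et⟩ := ht
    refine ⟨F.bin_mem (hμ g) hs ht, ?_⟩
    rw [evalPos, es, et]
    exact F.bin_toGr _ _ _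

theorem eval_toGr {G A : Type} [Finite A] (w : G → ℕ) (μ : G → P.obj (Fin 2))
    (hμ : ∀ g, μ g ∈ F.level (w g) (Fin 2)) (t : BTree G A) {n : ℕ} (hn : t.weight w = n) :
    ∃ h, F.gr.eval (fun g => F.toGr (w g) (μ g) (hμ g)) t = F.toGr n (P.eval μ t) h := by
  subst hn
  by_cases ht : t.IsMultilinear
  · obtain ⟨h, e⟩ := F.evalPos_toGr w μ hμ t
    have h' : P.eval μ t ∈ F.level (t.weight w) A := by
      rw [eval, dif_pos ht]; exact F.relabel_mem _ _ _ h
    refine ⟨h', ?_⟩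
    rw [eval, dif_pos ht, e, relabel_toGr]
    exact F.toGr_congr _ _ rfl (by rw [eval, dif_pos ht])
  · have h0 : P.eval μ t = 0 := by rw [eval, dif_neg ht]
    refine ⟨by rw [h0]; exact zero_mem _, ?_⟩
    rw [eval, dif_neg ht, toGr_eq_zero]
    rw [h0]; exact zero_mem _

end OperadFiltration

theorem gr_associativityRelator :
    (lieFiltration k).gr.associativityRelator (grSymProduct k) = 0 := by
  have E := fun t : BTree Unit (Fin 3) => (lieFiltration k).eval_toGr (fun _ => 0)
    (fun _ => symProduct k) (fun _ => mem_lieFiltration_zero _) t (n := 0)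
  obtain ⟨h1, e1⟩ := E (.node () (.node () (.leaf 0) (.leaf 1)) (.leaf 2)) rfl
  obtain ⟨h2, e2⟩ := E (.node () (.leaf 0) (.node () (.leaf 1) (.leaf 2))) rfl
  refine (congrArg₂ (· - ·) e1 e2).trans ?_
  rw [← OperadFiltration.toGr_sub]
  exact OperadFiltration.toGr_eq_zero _ _ associativityRelator_mem

theorem gr_jacobiRelator :
    (lieFiltration k).gr.jacobiRelator (grLieBracket k) = 0 := by
  have E := fun t : BTree Unit (Fin 3) => (lieFiltration k).eval_toGr (fun _ => 1)
    (fun _ => lieBracket k) (fun _ => lieBracket_mem) t (n := 2)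
  obtain ⟨h1, e1⟩ := E (.node () (.node () (.leaf 0) (.leaf 1)) (.leaf 2)) rfl
  obtain ⟨h2, e2⟩ := E (.node () (.node () (.leaf 1) (.leaf 2)) (.leaf 0)) rfl
  obtain ⟨h3, e3⟩ := E (.node () (.node () (.leaf 2) (.leaf 0)) (.leaf 1)) rfl
  refine (congrArg₂ (· + ·) (congrArg₂ (· + ·) e1 e2) e3).trans ?_
  rw [← OperadFiltration.toGr_add, ← OperadFiltration.toGr_add]
  exact OperadFiltration.toGr_eq_zero _ _ (jacobiRelator_mem _)

/-- The degree of a generator of the F-manifold operad in the associated graded operad. -/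
def FManGen.degree : FManGen → ℕ
  | .prod => 0
  | .bracket => 1

/-- Each of the nine monomials contains exactly one bracket, so all their cosets lie in F¹/F²; the
relator of representatives lies in F². -/
theorem gr_hertlingManinRelator :
    (lieFiltration k).gr.hertlingManinRelator (grSymProduct k) (grLieBracket k) = 0 := by
  have hμ : ∀ g, (PreLie k).fManSubst (symProduct k) (lieBracket k) g
      ∈ (lieFiltration k).level (FManGen.degree g) (Fin 2) := by
    rintro (_ | _)
    exacts [mem_lieFiltration_zero _, lieBracket_mem]
  have E := fun (t : BTree FManGen (Fin 4)) (ht : t.weight FManGen.degree = 1) =>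
    (lieFiltration k).eval_toGr FManGen.degree _ hμ t ht
  have hs : (fun g => (lieFiltration k).toGr (FManGen.degree g) _ (hμ g))
      = (lieFiltration k).gr.fManSubst (grSymProduct k) (grLieBracket k) := by
    funext g; cases g <;> rfl
  rw [hs] at E
  let m : BTree FManGen (Fin 4) → BTree FManGen (Fin 4) → BTree FManGen (Fin 4) := .node .prod
  let b : BTree FManGen (Fin 4) → BTree FManGen (Fin 4) → BTree FManGen (Fin 4) := .node .bracket
  obtain ⟨h1, e1⟩ := E (b (m (.leaf 0) (.leaf 1)) (m (.leaf 2) (.leaf 3))) rfl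
  obtain ⟨h2, e2⟩ := E (m (b (m (.leaf 0) (.leaf 1)) (.leaf 2)) (.leaf 3)) rfl
  obtain ⟨h3, e3⟩ := E (m (b (m (.leaf 0) (.leaf 1)) (.leaf 3)) (.leaf 2)) rfl
  obtain ⟨h4, e4⟩ := E (m (.leaf 0) (b (.leaf 1) (m (.leaf 2) (.leaf 3)))) rfl
  obtain ⟨h5, e5⟩ := E (m (.leaf 1) (b (.leaf 0) (m (.leaf 2) (.leaf 3)))) rfl
  obtain ⟨h6, e6⟩ := E (m (m (.leaf 0) (.leaf 2)) (b (.leaf 1) (.leaf 3))) rfl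
  obtain ⟨h7, e7⟩ := E (m (m (.leaf 1) (.leaf 2)) (b (.leaf 0) (.leaf 3))) rfl
  obtain ⟨h8, e8⟩ := E (m (m (.leaf 1) (.leaf 3)) (b (.leaf 0) (.leaf 2))) rfl
  obtain ⟨h9, e9⟩ := E (m (m (.leaf 0) (.leaf 3)) (b (.leaf 1) (.leaf 2))) rfl
  refine (congrArg₂ (· - ·) e1 (congrArg₂ (· - ·) (congrArg₂ (· - ·) (congrArg₂ (· - ·)
    (congrArg₂ (· - ·) (congrArg₂ (· + ·) (congrArg₂ (· + ·) (congrArg₂ (· + ·) e2 e3) e4) e5)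
      e6) e7) e8) e9)).trans ?_
  rw [← OperadFiltration.toGr_add, ← OperadFiltration.toGr_add, ← OperadFiltration.toGr_add,
    ← OperadFiltration.toGr_sub, ← OperadFiltration.toGr_sub, ← OperadFiltration.toGr_sub,
    ← OperadFiltration.toGr_sub, ← OperadFiltration.toGr_sub]
  exact OperadFiltration.toGr_eq_zero _ _ hertlingManinRelator_mem

/-! ### Symmetry of the two cosets -/

theorem opp_opp (P : SymmetricOperad k) (μ : P.obj (Fin 2)) : P.opp (P.opp μ) = μ := by
  rw [opp, opp, relabel_relabel, show (Equiv.swap (0 : Fin 2) 1).trans (Equiv.swap 0 1)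
    = Equiv.refl _ from Equiv.swap_swap 0 1, P.relabel_refl]

theorem opp_grSymProduct : (lieFiltration k).gr.opp (grSymProduct k) = grSymProduct k := by
  refine ((lieFiltration k).relabel_toGr _ _).trans ((lieFiltration k).toGr_congr _ _ rfl ?_)
  change (PreLie k).opp (symProduct k) = symProduct k
  rw [symProduct, opp, map_add]
  change (PreLie k).opp _ + (PreLie k).opp _ = _
  rw [opp_opp, add_comm]

theorem opp_grLieBracket : (lieFiltration k).gr.opp (grLieBracket k) + grLieBracket k = 0 := by
  have h : (PreLie k).opp (lieBracket k) + lieBracket k = 0 := by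
    rw [lieBracket, opp, map_sub]
    change (PreLie k).opp _ - (PreLie k).opp _ + _ = _
    rw [opp_opp, sub_add_sub_cancel, sub_self]
  refine (congrArg (· + grLieBracket k) ((lieFiltration k).relabel_toGr _ _)).trans ?_
  refine ((lieFiltration k).toGr_add _ lieBracket_mem).symm.trans
    ((lieFiltration k).toGr_eq_zero _ ?_)
  change (PreLie k).opp (lieBracket k) + lieBracket k ∈ _
  rw [h]
  exact zero_mem _

/-! ## Generation -/

theorem InSuboperad.bin {P : SymmetricOperad k} {S : (n : ℕ) → Set (P.obj (Fin n))}
    {μ : P.obj (Fin 2)} (hμ : P.InSuboperad S (Fin 2) μ) {A B : Type} [Finite A] [Finite B]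
    {x : P.obj A} {y : P.obj B} (hx : P.InSuboperad S A x) (hy : P.InSuboperad S B y) :
    P.InSuboperad S (A ⊕ B) (P.bin μ x y) :=
  .comp _ _ _ _ (.relabel _ _ _ _ (.comp _ _ _ _ (.relabel _ _ _ _ hμ) hx)) hy

theorem InSuboperad.evalPos {P : SymmetricOperad k} {S : (n : ℕ) → Set (P.obj (Fin n))}
    {G A : Type} {μ : G → P.obj (Fin 2)} (hμ : ∀ g, P.InSuboperad S (Fin 2) (μ g))
    (t : BTree G A) : P.InSuboperad S t.Pos (P.evalPos μ t) := by
  induction t with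
  | leaf a => exact .one
  | node g s t hs ht => exact (hμ g).bin hs ht

theorem InSuboperad.eval {P : SymmetricOperad k} {S : (n : ℕ) → Set (P.obj (Fin n))}
    {G A : Type} [Finite A] {μ : G → P.obj (Fin 2)} (hμ : ∀ g, P.InSuboperad S (Fin 2) (μ g))
    (t : BTree G A) : P.InSuboperad S A (P.eval μ t) := by
  unfold SymmetricOperad.eval
  split_ifs
  · exact .relabel _ _ _ _ (.evalPos hμ t)
  · exact .zero A

theorem preLie_isGeneratedBy_product {S : (n : ℕ) → Set ((PreLie k).obj (Fin n))}
    (h : (PreLie k).InSuboperad S (Fin 2) (preLieProduct k)) : (PreLie k).IsGeneratedBy S := by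
  intro A _ x
  obtain ⟨x, rfl⟩ := preLieProj_surjective A x
  induction x using free_induction with
  | zero => rw [map_zero]; exact .zero A
  | add x y hx hy => rw [map_add]; exact .add _ _ _ hx hy
  | smul c x hx => rw [map_smul]; exact .smul _ _ _ hx
  | tree t =>
    -- A tree monomial is its own evaluation at the generators: both give the same tree under
    -- `plug`, and the multilinear part recovers the element.
    have e : freeTree k t = (free k Unit).eval (freeGen k) t.1 := by
      have e1 := multilinearPart_plug (k := k) Function.bijective_id (freeTree k t)
      have e2 := multilinearPart_plug (k := k) Function.bijective_id
        ((free k Unit).eval (freeGen k) t.1)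
      have e3 : Equiv.ofBijective id Function.bijective_id = Equiv.refl A := Equiv.ext fun _ => rfl
      rw [e3, relabel_refl] at e1 e2
      rw [← e1, ← e2, plug_eval _ t.2, plug_freeTree]
    rw [e, Hom.map_eval]
    exact .eval (fun _ => h) t.1

theorem preLie_isGeneratedBy [CharZero k] : (PreLie k).IsGeneratedBy (fun n =>
    {x | BinaryPair (PreLie k) (symProduct k) (lieBracket k) n x}) := by
  apply preLie_isGeneratedBy_product
  have e : preLieProduct k = (2⁻¹ : k) • (symProduct k + lieBracket k) := by
    -- Characteristic zero enters here, through the invertibility of 2.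
    have h2 : (2 : k) ≠ 0 := two_ne_zero
    rw [eq_inv_smul_iff₀ h2, symProduct, lieBracket, two_smul]
    abel
  rw [e]
  exact .smul _ _ _ (.add _ _ _ (.mem 2 _ .left) (.mem 2 _ .right))

/-! ## The morphism from the F-manifold operad -/

variable (k) in
/-- The morphism from the operad of F-manifold algebras to the associated graded operad. -/
noncomputable def fManHom : Hom (FMan k) (lieFiltration k).gr :=
  ((lieFiltration k).gr.freeLift
    ((lieFiltration k).gr.fManSubst (grSymProduct k) (grLieBracket k))).quotientLift
    (FManRelation k) (by
      rintro _ _ (_ | _ | _ | _ | _)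
      · rw [map_sub, opp, Hom.map_relabel, freeLift_freeGen]
        exact sub_eq_zero.2 opp_grSymProduct
      · rw [map_add, opp, Hom.map_relabel, freeLift_freeGen]
        exact opp_grLieBracket
      · refine Eq.trans ?_ gr_associativityRelator
        simp only [associativityRelator, map_sub, Hom.map_eval, freeLift_freeGen]
        rfl
      · refine Eq.trans ?_ gr_jacobiRelator
        simp only [jacobiRelator, map_add, Hom.map_eval, freeLift_freeGen]
        rfl
      · refine Eq.trans ?_ gr_hertlingManinRelator
        have e : (fun g => ((lieFiltration k).gr.freeLift ((lieFiltration k).gr.fManSubst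
            (grSymProduct k) (grLieBracket k))).app (Fin 2) ((free k FManGen).fManSubst
            (freeGen k .prod) (freeGen k .bracket) g))
            = (lieFiltration k).gr.fManSubst (grSymProduct k) (grLieBracket k) := by
          funext g
          cases g <;> exact freeLift_freeGen _ _ _
        simp only [hertlingManinRelator, map_sub, map_add, Hom.map_eval, e])

theorem fManHom_fManOp (g : FManGen) : (fManHom k).app (Fin 2) (fManOp k g)
    = (lieFiltration k).gr.fManSubst (grSymProduct k) (grLieBracket k) g :=
  freeLift_freeGen _ _ g

theorem fManHom_bracket : (fManHom k).app (Fin 2) (fManOp k .bracket)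
    = (lieFiltration k).toGr 1 (lieBracket k) lieBracket_mem :=
  fManHom_fManOp .bracket

/-! ### Surjectivity onto the graded operad -/

/-- The image of a morphism is a suboperad and taking degree-zero cosets respects the operad
structure, so generators of PL suffice. -/
theorem toGr_zero_mem_range_fManHom [CharZero k] {A : Type} [Finite A] (x : (PreLie k).obj A) :
    (lieFiltration k).toGr 0 x (mem_lieFiltration_zero x) ∈ LinearMap.range ((fManHom k).app A) := by
  induction preLie_isGeneratedBy A x with
  | mem n x hx =>
    rcases hx with _ | _
    · exact ⟨_, fManHom_fManOp .prod⟩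
    -- In degree zero the bracket has coset zero, since it lies in F¹; its image in F¹/F² plays no
    -- role here.
    · rw [OperadFiltration.toGr_eq_zero _ _ lieBracket_mem]
      exact zero_mem _
  | one => exact ⟨_, (fManHom k).map_one⟩
  | zero A =>
    rw [OperadFiltration.toGr_eq_zero _ _ (zero_mem _)]
    exact zero_mem _
  | add A x y _ _ hx hy =>
    rw [OperadFiltration.toGr_add _ (mem_lieFiltration_zero x) (mem_lieFiltration_zero y)]
    exact add_mem hx hy
  | smul A c x _ hx =>
    rw [OperadFiltration.toGr_smul _ c (mem_lieFiltration_zero x)]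
    exact Submodule.smul_mem _ c hx
  | relabel A B e x _ hx =>
    obtain ⟨z, hz⟩ := hx
    refine ⟨(FMan k).relabel e z, ?_⟩
    rw [Hom.map_relabel, hz, OperadFiltration.relabel_toGr]
  | comp A B x y _ _ hx hy =>
    obtain ⟨z, hz⟩ := hx
    obtain ⟨w, hw⟩ := hy
    refine ⟨(FMan k).comp z w, ?_⟩
    rw [Hom.map_comp, hz, hw, OperadFiltration.comp_toGr]

/-- Marked vertices go to the coset of the bracket in F¹/F², all other vertices to cosets in F⁰/F¹,
which are already known to be in the image. -/
theorem IsTreeTensor.toGr_mem_range_fManHom [CharZero k] {n : ℕ} {A : Type} [Finite A]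
    {x : (PreLie k).obj A}
    (hx : (PreLie k).IsTreeTensor (fun n => {x | BinarySingleton (PreLie k) (lieBracket k) n x})
      n A x) :
    ∃ h, (lieFiltration k).toGr n x h ∈ LinearMap.range ((fManHom k).app A) := by
  induction hx with
  | mem n x hx =>
    cases hx
    exact ⟨lieBracket_mem, fManOp k .bracket, fManHom_bracket⟩
  | any A x => exact ⟨_, toGr_zero_mem_range_fManHom x⟩
  | relabel n A B e x _ hx =>
    obtain ⟨h, z, hz⟩ := hx
    refine ⟨(lieFiltration k).relabel_mem _ _ _ h, (FMan k).relabel e z, ?_⟩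
    rw [Hom.map_relabel, hz, OperadFiltration.relabel_toGr]
  | comp m n A B x y _ _ hx hy =>
    obtain ⟨h, z, hz⟩ := hx
    obtain ⟨h', w, hw⟩ := hy
    refine ⟨(lieFiltration k).comp_mem _ _ _ _ h h', (FMan k).comp z w, ?_⟩
    rw [Hom.map_comp, hz, hw, OperadFiltration.comp_toGr]

theorem fManHom_isSurjective [CharZero k] : (fManHom k).IsSurjective := by
  intro A _ y
  rw [← LinearMap.mem_range]
  induction y using (lieFiltration k).grObj_induction with
  | h0 => exact zero_mem _
  | ha y z hy hz => exact add_mem hy hz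
  | hc n x hx =>
  -- Quantifying over the membership proof keeps the coset independent of the derivation on which
  -- the span induction runs.
  have key : ∀ h : x ∈ (lieFiltration k).level n A,
      (lieFiltration k).toGr n x h ∈ LinearMap.range ((fManHom k).app A) := by
    induction hx using Submodule.span_induction with
    | mem x hx =>
      intro h
      obtain ⟨j, hj, ht⟩ := hx
      obtain ⟨_, hr⟩ := ht.toGr_mem_range_fManHom
      -- A tree tensor with more than `n` marked vertices already lies in level `n + 1`, so its
      -- coset is zero.
      rcases hj.eq_or_lt with rfl | hlt
      · exact hr
      · rw [OperadFiltration.toGr_eq_zero _ h (Submodule.subset_span ⟨j, hlt, ht⟩)]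
        exact zero_mem _
    | zero =>
      intro h
      rw [OperadFiltration.toGr_eq_zero _ h (zero_mem _)]
      exact zero_mem _
    | add x y h h' hx hy =>
      intro _
      rw [OperadFiltration.toGr_add (lieFiltration k) h h']
      exact add_mem (hx h) (hy h')
    | smul c x h hx =>
      intro _
      rw [OperadFiltration.toGr_smul (lieFiltration k) c h]
      exact Submodule.smul_mem _ c (hx h)
  exact key hx

end SymmetricOperad

theorem mainTheorem4 (k : Type u) [Field k] [CharZero k] :
    (∃ φ : SymmetricOperad.Hom (SymmetricOperad.FMan k) (SymmetricOperad.lieFiltration k).gr,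
      φ.IsSurjective ∧
      φ.app (Fin 2) (SymmetricOperad.fManOp k .prod) = SymmetricOperad.grSymProduct k ∧
      φ.app (Fin 2) (SymmetricOperad.fManOp k .bracket) = SymmetricOperad.grLieBracket k) ∧
    (SymmetricOperad.lieFiltration k).gr.associativityRelator
      (SymmetricOperad.grSymProduct k) = 0 ∧
    (SymmetricOperad.lieFiltration k).gr.hertlingManinRelator
      (SymmetricOperad.grSymProduct k) (SymmetricOperad.grLieBracket k) = 0 ∧
    (SymmetricOperad.PreLie k).IsGeneratedBy (fun n =>
      {x | SymmetricOperad.BinaryPair (SymmetricOperad.PreLie k)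
        (SymmetricOperad.symProduct k) (SymmetricOperad.lieBracket k) n x}) :=
  ⟨⟨SymmetricOperad.fManHom k, SymmetricOperad.fManHom_isSurjective,
      SymmetricOperad.fManHom_fManOp .prod, SymmetricOperad.fManHom_fManOp .bracket⟩,
    SymmetricOperad.gr_associativityRelator, SymmetricOperad.gr_hertlingManinRelator,
    SymmetricOperad.preLie_isGeneratedBy⟩
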